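/- Let $\Lambda$ be a commutative local ring which is uniserial (its ideals are linearly ordered by inclusion) and has finite length $n\ge 7$ as a module over itself, and let $k$ be its residue field. Let $\mathcal S(\Lambda)$ be the category whose objects are the pairs $(M_0,M_1)$ consisting of a finitely generated $\Lambda$-module $M_0$ and a $\Lambda$-submodule $M_1\subseteq M_0$, and whose morphisms $(M_0,M_1)\to(N_0,N_1)$ are the $\Lambda$-linear maps $f\colon M_0\to N_0$ with $f(M_1)\subseteq N_1$. For a full subcategory $\mathcal C$ of an additive category $\mathcal A$, write $\operatorname{Hom}(A,A')_{\mathcal C}$ for the set of all morphisms $A\to A'$ of $\mathcal A$ which factor through a finite direct sum of objects of $\mathcal C$; for a full subcategory $\mathcal B\supseteq\mathcal C$ of $\mathcal A$, let $\mathcal B/\langle\mathcal C\rangle$ be the category with the objects of $\mathcal B$ and with morphism groups $\operatorname{Hom}_{\mathcal A}(A,A')/\operatorname{Hom}(A,A')_{\mathcal C}$. Then $\mathcal S(\Lambda)$ is controlled $k$-wild, that is, there are full subcategories $\mathcal C\subseteq\mathcal B\subseteq\mathcal S(\Lambda)$ such that $\mathcal B/\langle\mathcal C\rangle$ is equivalent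 to the category $\operatorname{mod} k\langle X,Y\rangle$ of modules, finite-dimensional over $k$, over the free $k$-algebra $k\langle X,Y\rangle$ in two generators. Moreover, $\mathcal C$ can be taken to consist of a single object $I$ of $\mathcal S(\Lambda)$ (a control object). -/

import Mathlib

universe u v w

open CategoryTheory CategoryTheory.Limits

/-! ### The submodule category of a ring -/

/-- An object of the submodule category of `R`: a finitely generated `R`-module `M₀` (the field
`carrier`) together with a submodule `M₁ ⊆ M₀` (the field `sub`). -/
structure SubmodulePair (R : Type u) [CommRing R] where
  carrier : Type u
  [addCommGroup : AddCommGroup carrier]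
  [module : Module R carrier]
  [finite : Module.Finite R carrier]
  sub : Submodule R carrier

namespace SubmodulePair

variable {R : Type u} [CommRing R]

attribute [instance] addCommGroup module finite

/-- A morphism `M ⟶ N` is an `R`-linear map `f : M₀ → N₀` such that `f(M₁) ⊆ N₁`. -/
@[ext]
structure Hom (M N : SubmodulePair R) where
  toLinearMap : M.carrier →ₗ[R] N.carrier
  map_sub : M.sub.map toLinearMap ≤ N.sub

variable {M N : SubmodulePair R}

theorem Hom.apply_mem (f : Hom M N) {x : M.carrier} (hx : x ∈ M.sub) :
    f.toLinearMap x ∈ N.sub :=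
  f.map_sub (Submodule.mem_map_of_mem hx)

theorem Hom.toLinearMap_injective :
    Function.Injective (Hom.toLinearMap : Hom M N → (M.carrier →ₗ[R] N.carrier)) :=
  fun _ _ h => Hom.ext h

/-- A linear map that sends elements of `M₁` to elements of `N₁`, as a morphism. -/
def Hom.mk' (f : M.carrier →ₗ[R] N.carrier) (hf : ∀ x ∈ M.sub, f x ∈ N.sub) : Hom M N where
  toLinearMap := f
  map_sub := Submodule.map_le_iff_le_comap.2 hf

instance : Zero (Hom M N) := ⟨Hom.mk' 0 fun _ _ => N.sub.zero_mem⟩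
instance : Add (Hom M N) :=
  ⟨fun f g => Hom.mk' (f.toLinearMap + g.toLinearMap) fun _ hx =>
    N.sub.add_mem (f.apply_mem hx) (g.apply_mem hx)⟩
instance : Neg (Hom M N) :=
  ⟨fun f => Hom.mk' (-f.toLinearMap) fun _ hx => N.sub.neg_mem (f.apply_mem hx)⟩
instance : Sub (Hom M N) :=
  ⟨fun f g => Hom.mk' (f.toLinearMap - g.toLinearMap) fun _ hx =>
    N.sub.sub_mem (f.apply_mem hx) (g.apply_mem hx)⟩
instance : SMul ℕ (Hom M N) :=
  ⟨fun n f => Hom.mk' (n • f.toLinearMap) fun _ hx => N.sub.nsmul_mem (f.apply_mem hx) n⟩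
instance : SMul ℤ (Hom M N) :=
  ⟨fun n f => Hom.mk' (n • f.toLinearMap) fun _ hx => zsmul_mem (f.apply_mem hx) n⟩

instance : AddCommGroup (Hom M N) :=
  Hom.toLinearMap_injective.addCommGroup _ rfl (fun _ _ => rfl) (fun _ => rfl)
    (fun _ _ => rfl) (fun _ _ => rfl) (fun _ _ => rfl)

/-- The submodule category of `R`. -/
instance : Category.{u} (SubmodulePair R) where
  Hom M N := Hom M N
  id M := Hom.mk' LinearMap.id fun _ hx => hx
  comp f g := Hom.mk' (g.toLinearMap.comp f.toLinearMap) fun _ hx =>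
    g.apply_mem (f.apply_mem hx)

@[ext]
theorem hom_ext {f g : M ⟶ N} (h : f.toLinearMap = g.toLinearMap) : f = g :=
  Hom.ext h

/-- Addition of morphisms is addition of linear maps. -/
instance : Preadditive (SubmodulePair R) where
  homGroup M N := inferInstanceAs (AddCommGroup (Hom M N))
  add_comp _ _ _ _ _ _ := Hom.ext (LinearMap.comp_add _ _ _)
  comp_add _ _ _ _ _ _ := Hom.ext (LinearMap.add_comp _ _ _)

@[simp]
theorem id_toLinearMap (M : SubmodulePair R) : Hom.toLinearMap (𝟙 M) = LinearMap.id := rfl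

@[simp]
theorem comp_toLinearMap {P : SubmodulePair R} (f : M ⟶ N) (g : N ⟶ P) :
    Hom.toLinearMap (f ≫ g) = g.toLinearMap.comp f.toLinearMap := rfl

@[simp]
theorem zero_toLinearMap : Hom.toLinearMap (0 : M ⟶ N) = 0 := rfl

@[simp]
theorem add_toLinearMap (f g : M ⟶ N) :
    Hom.toLinearMap (f + g) = f.toLinearMap + g.toLinearMap := rfl

theorem sum_toLinearMap {ι : Type*} (s : Finset ι) (f : ι → (M ⟶ N)) :
    Hom.toLinearMap (∑ i ∈ s, f i) = ∑ i ∈ s, (f i).toLinearMap := by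
  classical
  induction s using Finset.induction_on with
  | empty => rfl
  | insert a s ha ih => rw [Finset.sum_insert ha, Finset.sum_insert ha, add_toLinearMap, ih]

/-- The componentwise direct sum `(⨁ i, (M i)₀, ⨁ i, (M i)₁)` of a finite family. -/
def pi {ι : Type} [Finite ι] (M : ι → SubmodulePair R) : SubmodulePair R where
  carrier := ∀ i, (M i).carrier
  sub := Submodule.pi Set.univ fun i => (M i).sub

open Classical in
/-- The projections and inclusions of the componentwise direct sum. -/
noncomputable def piBicone {ι : Type} [Finite ι] (M : ι → SubmodulePair R) : Bicone M where
  pt := pi M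
  π i := Hom.mk' (LinearMap.proj i) fun _ hx => hx i trivial
  ι i := Hom.mk' (LinearMap.single R (fun j => (M j).carrier) i) fun x hx j _ => by
    change Pi.single (M := fun j => (M j).carrier) i x j ∈ (M j).sub
    rcases eq_or_ne j i with rfl | h
    · rwa [Pi.single_eq_same]
    · rw [Pi.single_eq_of_ne h]
      exact (M j).sub.zero_mem
  ι_π i j := by
    split_ifs with h
    · subst h
      apply SubmodulePair.hom_ext
      ext x
      exact Pi.single_eq_same (M := fun j => (M j).carrier) i x
    · apply SubmodulePair.hom_ext
      ext x
      exact Pi.single_eq_of_ne' (M := fun j => (M j).carrier) h x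

theorem piBicone_total {ι : Type} [Fintype ι] (M : ι → SubmodulePair R) :
    ∑ i, (piBicone M).π i ≫ (piBicone M).ι i = 𝟙 (piBicone M).pt := by
  classical
  apply SubmodulePair.hom_ext
  rw [sum_toLinearMap]
  refine LinearMap.ext fun x => ?_
  rw [LinearMap.sum_apply]
  refine Eq.trans (Finset.sum_congr rfl fun i _ => ?_)
    (Finset.univ_sum_single (M := fun j => (M j).carrier) x)
  change Pi.single (M := fun j => (M j).carrier) i (x i) = _
  congr

/-- The submodule category is an additive category. -/
instance : HasFiniteBiproducts (SubmodulePair R) where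
  out _ := ⟨fun M => hasBiproduct_of_total (piBicone M) (piBicone_total M)⟩

end SubmodulePair

/-! ### Controlled wildness -/

section ControlledWild

variable {A : Type v} [Category.{w} A] [Preadditive A] [HasFiniteBiproducts A]

/-- `f` lies in `Hom(X, Y)_C`: it factors through a finite direct sum of objects in `C`. -/
def FactorsThroughSum (C : ObjectProperty A) {X Y : A} (f : X ⟶ Y) : Prop :=
  ∃ (J : Type) (_ : Fintype J) (D : J → A),
    (∀ j, C (D j)) ∧ ∃ (g : X ⟶ ⨁ D) (h : ⨁ D ⟶ Y), g ≫ h = f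

/-- Equivalently, `f` lies in the ideal generated by the identities of the objects in `C`. -/
theorem factorsThroughSum_iff (C : ObjectProperty A) {X Y : A} (f : X ⟶ Y) :
    FactorsThroughSum C f ↔ ∃ (J : Type) (_ : Fintype J) (D : J → A),
      (∀ j, C (D j)) ∧ ∃ (g : ∀ j, X ⟶ D j) (h : ∀ j, D j ⟶ Y), ∑ j, g j ≫ h j = f := by
  constructor
  · rintro ⟨J, _, D, hD, g, h, rfl⟩
    refine ⟨J, ‹_›, D, hD, fun j => g ≫ biproduct.π D j, fun j => biproduct.ι D j ≫ h, ?_⟩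
    simp_rw [Category.assoc]
    rw [← Preadditive.comp_sum]
    simp_rw [← Category.assoc (biproduct.π D _)]
    rw [← Preadditive.sum_comp, biproduct.total, Category.id_comp]
  · rintro ⟨J, _, D, hD, g, h, rfl⟩
    exact ⟨J, ‹_›, D, hD, biproduct.lift g, biproduct.desc h, biproduct.lift_desc⟩

/-- Congruence modulo the ideal `⟨C⟩`, on the full subcategory `B`. -/
def modIdeal (B C : ObjectProperty A) : HomRel B.FullSubcategory :=
  fun _ _ f g => FactorsThroughSum C (B.ι.map f - B.ι.map g)

instance (B C : ObjectProperty A) : Congruence (modIdeal B C) where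
  comp_left f g g' := by
    rintro ⟨J, _, D, hD, a, b, hab⟩
    exact ⟨J, ‹_›, D, hD, B.ι.map f ≫ a, b, by simp [hab]⟩
  comp_right g := by
    rintro ⟨J, _, D, hD, a, b, hab⟩
    exact ⟨J, ‹_›, D, hD, a, b ≫ B.ι.map g, by simp [← Category.assoc, hab]⟩
  equivalence :=
    { refl := fun f => ⟨PEmpty, inferInstance, PEmpty.elim, fun j => j.elim, 0, 0, by simp⟩
      symm := by
        rintro f g ⟨J, _, D, hD, a, b, hab⟩
        exact ⟨J, ‹_›, D, hD, -a, b, by rw [Preadditive.neg_comp, hab, neg_sub]⟩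
      trans := by
        intro f g h h₁ h₂
        obtain ⟨J, _, D, hD, a, b, hab⟩ := (factorsThroughSum_iff _ _).1 h₁
        obtain ⟨J', _, D', hD', a', b', hab'⟩ := (factorsThroughSum_iff _ _).1 h₂
        refine (factorsThroughSum_iff _ _).2 ⟨J ⊕ J', inferInstance, Sum.elim D D',
          Sum.rec hD hD', Sum.rec a a', Sum.rec b b', ?_⟩
        rw [Fintype.sum_sum_type]
        exact (congrArg₂ (· + ·) hab hab').trans (sub_add_sub_cancel _ _ _) }

/-- The factor category `B/⟨C⟩`: its objects are those of `B`, and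
`Hom(X, Y) = Hom_A(X, Y) / Hom(X, Y)_C`. -/
abbrev FactorCategory (B C : ObjectProperty A) : Type v :=
  CategoryTheory.Quotient (modIdeal B C)

end ControlledWild

open scoped ModuleCat.Algebra in
/-- `mod k⟨X, Y⟩`: the category of modules over the free algebra in two generators which are
finite-dimensional over `k`. -/
abbrev FreeAlgebraMod (k : Type u) [Field k] : Type (u + 1) :=
  ObjectProperty.FullSubcategory
    (fun M : ModuleCat.{u} (FreeAlgebra k (Fin 2)) => Module.Finite k M)

/-- `C` is a control class which makes the additive category `A` controlled `k`-wild: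
`C ⊆ B ⊆ A` and `B/⟨C⟩` is equivalent to `mod k⟨X, Y⟩`, for some full subcategory `B`. -/
def IsControlClass (k : Type u) [Field k] {A : Type v} [Category.{w} A] [Preadditive A]
    [HasFiniteBiproducts A] (C : ObjectProperty A) : Prop :=
  ∃ B : ObjectProperty A, C ≤ B ∧ Nonempty (FactorCategory B C ≌ FreeAlgebraMod k)

/-- The additive category `A` is controlled `k`-wild. -/
def IsControlledWild (k : Type u) [Field k] (A : Type v) [Category.{w} A] [Preadditive A]
    [HasFiniteBiproducts A] : Prop :=
  ∃ C : ObjectProperty A, IsControlClass k C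

/-- A ring is (left) uniserial if its (left) ideals form a chain. -/
def IsUniserialRing (R : Type u) [Ring R] : Prop :=
  ∀ I J : Ideal R, I ≤ J ∨ J ≤ I

/-! ### Uniserial local rings -/

section Uniserial

variable {R : Type u} [CommRing R]

/-! The ring enters only through a generator `t` of its maximal ideal for which `t ^ i * c = 0`
forces `t ^ (7 - i) ∣ c`, `i ≤ 7`. Over it, `model` encodes a free module `L` with an endomorphism
`φ` and an idempotent `ε`. The submodule `M₁` has generators `x v` of order `t⁴` and `y v` of order
`t²`. New elements of `M₀` make `t x v + y v` divisible by `t²`, `t² x v` by `t³`, and `t² x v + t y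
(φ v)` by `t⁴`, or even by `t⁵` when `v` is in the image of `ε`.

A morphism acts on `M₁` by a matrix `x v ↦ x (a v) + y (c v)`, `y v ↦ x (b v) + y (d v)`. It
respects divisibility, and comparing coefficients gives, modulo `t`, that `d = a`, that `a`
intertwines the endomorphisms, and that it preserves the images of the idempotents
(`matrix_diagonal`, `matrix_commute`, `matrix_marked`). On `t³ M₁ ≅ L/tL` the morphism acts as `a`,
so what remains is a linear map respecting an endomorphism and a subspace.

Such data contain pairs of endomorphisms `ξ, η` of a space `V`: take `V × V` with `(v₁, v₂) ↦ (ξ v₁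
+ η v₂, v₁)` and the subspace `V × 0`. The compatible maps are exactly `p × p` with `p` commuting
with `ξ` and `η` (`exists_companion_hom`, `exists_top_eq`).

A morphism is zero on `t³ M₁` if and only if it factors through sums of eight explicit pairs, whose
direct sum is the control object (`factorsThroughSum_iff_kills`). One direction holds because every
map to a control pair kills `t³ M₁`. For the other, a morphism with `a` divisible by `t` is reduced
to zero on `M₁` by subtracting four factoring maps, and the rest factors through the cyclic summands
of `M₀/M₁`. Lifting `k`-spaces to free modules turns this into a functor which is full and whose
kernel is the ideal of the control object (`exists_factorCategory_equivalence`). -/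

theorem exists_isUnit_mul_pow [IsLocalRing R] {t : R}
    (ht : IsLocalRing.maximalIdeal R = Ideal.span {t}) (hnil : IsNilpotent t) {x : R}
    (hx : x ≠ 0) : ∃ (i : ℕ) (y : R), IsUnit y ∧ x = t ^ i * y := by
  obtain ⟨N, hN⟩ := hnil
  have hnot : ¬ t ^ N ∣ x := by
    rw [hN, zero_dvd_iff]
    exact hx
  classical
  have hex : ∃ j, ¬ t ^ j ∣ x := ⟨N, hnot⟩
  let j := Nat.find hex
  have hj : ¬ t ^ j ∣ x := Nat.find_spec hex
  obtain ⟨i, hi⟩ : ∃ i, j = i + 1 := by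
    refine Nat.exists_eq_succ_of_ne_zero fun h => hj ?_
    rw [h, pow_zero]
    exact one_dvd x
  have hdvd : t ^ i ∣ x := by
    by_contra h
    have := Nat.find_min' hex h
    change j ≤ i at this
    omega
  obtain ⟨y, rfl⟩ := hdvd
  refine ⟨i, y, ?_, rfl⟩
  by_contra hy
  have : y ∈ IsLocalRing.maximalIdeal R := hy
  rw [ht, Ideal.mem_span_singleton] at this
  apply hj
  rw [hi, pow_succ]
  exact mul_dvd_mul_left _ this

/-- Up to a unit, `c` is a power `t ^ j`, and `t ^ (i + j) = 0` is possible only for `i + j > N`. -/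
theorem dvd_of_pow_mul_eq_zero [IsLocalRing R] {t : R}
    (ht : IsLocalRing.maximalIdeal R = Ideal.span {t}) (hnil : IsNilpotent t) {N : ℕ}
    (hN : t ^ N ≠ 0) {i : ℕ} (hi : i ≤ N + 1) {c : R} (hc : t ^ i * c = 0) :
    t ^ (N + 1 - i) ∣ c := by
  by_cases h0 : c = 0
  · rw [h0]
    exact dvd_zero _
  obtain ⟨j, y, hy, rfl⟩ := exists_isUnit_mul_pow ht hnil h0
  rw [← mul_assoc, ← pow_add, hy.mul_left_eq_zero] at hc
  have : N < i + j := by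
    by_contra h
    exact hN (pow_eq_zero_of_le (not_lt.1 h) hc)
  exact dvd_mul_of_dvd_left (pow_dvd_pow t (by omega)) y

/-- By Nakayama there is `t` in the maximal ideal but not in its square. For `x` in the maximal
ideal, either `t` divides `x`, or `t = x * y` where `y` must be a unit. -/
theorem IsUniserialRing.exists_maximalIdeal_eq_span [IsLocalRing R] [IsNoetherianRing R]
    (h : IsUniserialRing R) : ∃ t : R, IsLocalRing.maximalIdeal R = Ideal.span {t} := by
  by_cases h0 : IsLocalRing.maximalIdeal R = ⊥
  · exact ⟨0, by rw [h0, Ideal.span_singleton_eq_bot.2 rfl]⟩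
  have hlt : ∃ t ∈ IsLocalRing.maximalIdeal R, t ∉ IsLocalRing.maximalIdeal R *
      IsLocalRing.maximalIdeal R := by
    by_contra! hcon
    exact h0 (Submodule.eq_bot_of_le_smul_of_le_jacobson_bot (IsLocalRing.maximalIdeal R)
      (IsLocalRing.maximalIdeal R) (IsNoetherian.noetherian _) hcon
      (IsLocalRing.maximalIdeal_le_jacobson _))
  obtain ⟨t, ht, ht2⟩ := hlt
  refine ⟨t, le_antisymm (fun x hx => ?_) ((Ideal.span_singleton_le_iff_mem _).2 ht)⟩
  rcases h (Ideal.span {x}) (Ideal.span {t}) with hle | hle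
  · exact hle (Ideal.mem_span_singleton_self x)
  · obtain ⟨y, rfl⟩ := Ideal.mem_span_singleton.1 (hle (Ideal.mem_span_singleton_self t))
    by_cases hy : IsUnit y
    · exact Ideal.mem_span_singleton.2 (hy.mul_right_dvd.2 dvd_rfl)
    · exact absurd (Ideal.mul_mem_mul hx hy) ht2

/-- An ideal is determined by the least power of `t` it contains, so a chain of ideals has at most
`N + 1` members. -/
theorem length_le_of_pow_eq_zero [IsLocalRing R] {t : R}
    (ht : IsLocalRing.maximalIdeal R = Ideal.span {t}) {N : ℕ} (hN : t ^ N = 0) :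
    Module.length R R ≤ N := by
  have hex : ∀ I : Ideal R, ∃ i, t ^ i ∈ I := fun I => ⟨N, by rw [hN]; exact I.zero_mem⟩
  classical
  let idx : Ideal R → ℕ := fun I => Nat.find (hex I)
  have hidx : ∀ I, idx I ≤ N := fun I => Nat.find_min' (hex I) (by rw [hN]; exact I.zero_mem)
  have hanti : StrictAnti idx := by
    intro I J hIJ
    refine lt_of_le_of_ne (Nat.find_min' (hex J) (hIJ.le (Nat.find_spec (hex I)))) fun heq => ?_
    refine hIJ.not_ge fun x hx => ?_
    by_cases h0 : x = 0
    · rw [h0]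
      exact I.zero_mem
    obtain ⟨i, y, hy, rfl⟩ := exists_isUnit_mul_pow ht ⟨N, hN⟩ h0
    have hi : idx J ≤ i := Nat.find_min' (hex J) ((Ideal.mul_unit_mem_iff_mem J hy).1 hx)
    have hI : t ^ idx I ∈ I := Nat.find_spec (hex I)
    rw [← heq] at hI
    exact I.mul_mem_right y (I.pow_mem_of_pow_mem hI hi)
  let F : Ideal R → (Fin (N + 1))ᵒᵈ := fun I =>
    OrderDual.toDual ⟨idx I, Nat.lt_succ_of_le (hidx I)⟩
  have hF : StrictMono F := fun I J hIJ => hanti hIJ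
  rw [← WithBot.coe_le_coe, Module.coe_length]
  refine iSup_le fun p => ?_
  have hp := LTSeries.length_lt_card (p.map F hF)
  rw [Fintype.card_orderDual, Fintype.card_fin] at hp
  have hp' : p.length ≤ N := Nat.le_of_lt_succ hp
  exact_mod_cast hp'

/-- A commutative local uniserial ring of finite length at least `N + 1` has a maximal ideal
generated by an element `t` such that annihilators of powers of `t` are as small as the
inequality `t ^ N ≠ 0` requires. -/
theorem IsUniserialRing.exists_uniformizer [IsLocalRing R] (h : IsUniserialRing R) {n N : ℕ}
    (hn : N + 1 ≤ n) (hlen : Module.length R R = n) :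
    ∃ t : R, IsLocalRing.maximalIdeal R = Ideal.span {t} ∧
      ∀ i ≤ N + 1, ∀ c : R, t ^ i * c = 0 → t ^ (N + 1 - i) ∣ c := by
  have hfin : IsFiniteLength R R := by
    rw [← Module.length_ne_top_iff, hlen]
    exact ENat.natCast_ne_top n
  obtain ⟨_, _⟩ := isFiniteLength_iff_isNoetherian_isArtinian.1 hfin
  have : IsArtinianRing R := ‹IsArtinian R R›
  have : IsNoetherianRing R := ‹IsNoetherian R R›
  obtain ⟨t, ht⟩ := h.exists_maximalIdeal_eq_span
  refine ⟨t, ht, fun i hi c hc => dvd_of_pow_mul_eq_zero ht ?_ (fun h0 => ?_) hi hc⟩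
  · obtain ⟨m, hm⟩ := IsArtinianRing.isNilpotent_jacobson_bot (R := R)
    refine ⟨m, ?_⟩
    rw [IsLocalRing.jacobson_eq_maximalIdeal ⊥ bot_ne_top, ht, Ideal.span_singleton_pow] at hm
    exact Ideal.span_singleton_eq_bot.1 hm
  · have := length_le_of_pow_eq_zero ht h0
    rw [hlen] at this
    have : n ≤ N := by exact_mod_cast this
    omega

end Uniserial

/-! ### Pairs given by generators and relations -/

namespace SubmodulePair

section Presentation

variable {R : Type u} [CommRing R] {L : Type u} [AddCommGroup L] [Module R L] {m : ℕ}

/-- The map whose range is the submodule of relations: the `i`-th relation sends the `j`-th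
generator to its coefficient `ρ i j`. -/
def relationMap (ρ : Fin m → Fin m → Module.End R L) : (Fin m → L) →ₗ[R] (Fin m → L) :=
  LinearMap.pi fun j => ∑ i, ρ i j ∘ₗ LinearMap.proj i

theorem relationMap_apply (ρ : Fin m → Fin m → Module.End R L) (c : Fin m → L) (j : Fin m) :
    relationMap ρ c j = ∑ i, ρ i j (c i) := by
  simp [relationMap]

/-- The pair with `m` generators, each of them parametrized linearly by `L`, and `m` relations;
the submodule is generated by the generators with index in `s`. -/
def presented [Module.Finite R L] (ρ : Fin m → Fin m → Module.End R L) (s : Set (Fin m)) :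
    SubmodulePair R where
  carrier := (Fin m → L) ⧸ LinearMap.range (relationMap ρ)
  sub := (Submodule.pi sᶜ fun _ => ⊥).map (Submodule.mkQ _)

variable [Module.Finite R L] {ρ : Fin m → Fin m → Module.End R L} {s : Set (Fin m)}

/-- The `j`-th generator of a presented pair. -/
def gen (ρ : Fin m → Fin m → Module.End R L) (s : Set (Fin m)) (j : Fin m) :
    L →ₗ[R] (presented ρ s).carrier :=
  Submodule.mkQ _ ∘ₗ LinearMap.single R (fun _ => L) j

theorem sum_gen (ρ : Fin m → Fin m → Module.End R L) (s : Set (Fin m)) (w : Fin m → L) :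
    ∑ j, gen ρ s j (w j) = Submodule.mkQ (LinearMap.range (relationMap ρ)) w := by
  conv_rhs => rw [← Finset.univ_sum_single w, map_sum]
  rfl

theorem exists_eq_sum_gen (x : (presented ρ s).carrier) :
    ∃ w : Fin m → L, x = ∑ j, gen ρ s j (w j) := by
  obtain ⟨w, rfl⟩ := Submodule.mkQ_surjective _ x
  exact ⟨w, (sum_gen ρ s w).symm⟩

theorem mem_sub_presented {x : (presented ρ s).carrier} :
    x ∈ (presented ρ s).sub ↔ ∃ w : Fin m → L, (∀ j ∉ s, w j = 0) ∧ x = ∑ j, gen ρ s j (w j) := by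
  constructor
  · rintro ⟨w, hw, rfl⟩
    exact ⟨w, fun j hj => hw j hj, (sum_gen ρ s w).symm⟩
  · rintro ⟨w, hw, rfl⟩
    exact ⟨w, fun j hj => hw j hj, (sum_gen ρ s w).symm⟩

theorem sum_gen_eq_zero {w : Fin m → L} :
    ∑ j, gen ρ s j (w j) = 0 ↔ ∃ c : Fin m → L, ∀ j, w j = ∑ i, ρ i j (c i) := by
  rw [sum_gen]
  refine (Submodule.Quotient.mk_eq_zero (LinearMap.range (relationMap ρ)) (x := w)).trans ?_
  rw [LinearMap.mem_range]
  constructor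
  · rintro ⟨c, rfl⟩
    exact ⟨c, relationMap_apply ρ c⟩
  · rintro ⟨c, hc⟩
    exact ⟨c, funext fun j => (relationMap_apply ρ c j).trans (hc j).symm⟩

theorem gen_relation (i : Fin m) (v : L) : ∑ j, gen ρ s j (ρ i j v) = 0 := by
  refine sum_gen_eq_zero.2 ⟨Pi.single i v, fun j => ?_⟩
  rw [Finset.sum_eq_single i (fun k _ hk => by rw [Pi.single_eq_of_ne hk, map_zero])
    (fun h => absurd (Finset.mem_univ i) h), Pi.single_eq_same]

theorem gen_mem_sub {j : Fin m} (hj : j ∈ s) (v : L) : gen ρ s j v ∈ (presented ρ s).sub := by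
  refine ⟨Pi.single j v, fun k hk => ?_, rfl⟩
  exact Pi.single_eq_of_ne (fun h : k = j => hk (by rwa [h])) _

/-- A morphism out of a presented pair is given by images of the generators which satisfy the
relations. -/
def presentedDesc {N : SubmodulePair R} (e : Fin m → L →ₗ[R] N.carrier)
    (he : ∀ i v, ∑ j, e j (ρ i j v) = 0) (hs : ∀ j ∈ s, ∀ v, e j v ∈ N.sub) :
    presented ρ s ⟶ N :=
  Hom.mk' (Submodule.liftQ _ (∑ j, e j ∘ₗ LinearMap.proj j) (by
    rintro _ ⟨c, rfl⟩
    rw [LinearMap.mem_ker, LinearMap.sum_apply]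
    simp only [LinearMap.comp_apply, LinearMap.proj_apply, relationMap_apply, map_sum]
    rw [Finset.sum_comm]
    exact Finset.sum_eq_zero fun i _ => he i (c i))) (by
    rintro _ ⟨w, hw, rfl⟩
    change (∑ j, e j ∘ₗ LinearMap.proj j) w ∈ N.sub
    rw [LinearMap.sum_apply]
    refine Submodule.sum_mem _ fun j _ => ?_
    by_cases hj : j ∈ s
    · exact hs j hj _
    · have : w j = 0 := hw j hj
      simp [this])

@[simp]
theorem presentedDesc_gen {N : SubmodulePair R} (e : Fin m → L →ₗ[R] N.carrier)
    (he : ∀ i v, ∑ j, e j (ρ i j v) = 0) (hs : ∀ j ∈ s, ∀ v, e j v ∈ N.sub) (j : Fin m) (v : L) :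
    (presentedDesc e he hs).toLinearMap (gen ρ s j v) = e j v := by
  change (∑ j, e j ∘ₗ LinearMap.proj j) (Pi.single j v) = _
  rw [LinearMap.sum_apply, Finset.sum_eq_single j (fun k _ hk => ?_)
    (fun h => absurd (Finset.mem_univ j) h)]
  · simp
  · simp [Pi.single_eq_of_ne hk]

theorem presented_hom_ext {N : SubmodulePair R} {f g : presented ρ s ⟶ N}
    (h : ∀ j v, f.toLinearMap (gen ρ s j v) = g.toLinearMap (gen ρ s j v)) : f = g := by
  apply SubmodulePair.hom_ext
  refine LinearMap.ext fun x => ?_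
  obtain ⟨w, rfl⟩ := exists_eq_sum_gen x
  simp only [map_sum, h]

end Presentation

end SubmodulePair

universe v' w'

/-! ### Ideals generated by control objects -/

section ControlClass

variable {A : Type v} [Category.{w} A] [Preadditive A] [HasFiniteBiproducts A]
  {C : ObjectProperty A} {X Y Z : A}

theorem FactorsThroughSum.comp_of_prop (hY : C Y) (f : X ⟶ Y) (g : Y ⟶ Z) :
    FactorsThroughSum C (f ≫ g) :=
  (factorsThroughSum_iff _ _).2 ⟨PUnit, inferInstance, fun _ => Y, fun _ => hY, fun _ => f,
    fun _ => g, by simp⟩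

theorem FactorsThroughSum.of_prop (hY : C Y) (f : X ⟶ Y) : FactorsThroughSum C f := by
  simpa using FactorsThroughSum.comp_of_prop hY f (𝟙 Y)

theorem FactorsThroughSum.zero : FactorsThroughSum C (0 : X ⟶ Y) :=
  (factorsThroughSum_iff _ _).2 ⟨PEmpty, inferInstance, PEmpty.elim, fun j => j.elim,
    fun j => j.elim, fun j => j.elim, by simp⟩

theorem FactorsThroughSum.add {f g : X ⟶ Y} (hf : FactorsThroughSum C f)
    (hg : FactorsThroughSum C g) : FactorsThroughSum C (f + g) := by
  obtain ⟨J, _, D, hD, a, b, hab⟩ := (factorsThroughSum_iff _ _).1 hf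
  obtain ⟨J', _, D', hD', a', b', hab'⟩ := (factorsThroughSum_iff _ _).1 hg
  refine (factorsThroughSum_iff _ _).2 ⟨J ⊕ J', inferInstance, Sum.elim D D',
    Sum.rec hD hD', Sum.rec a a', Sum.rec b b', ?_⟩
  rw [Fintype.sum_sum_type]
  exact congrArg₂ (· + ·) hab hab'

theorem FactorsThroughSum.sum {ι : Type*} (s : Finset ι) {f : ι → (X ⟶ Y)}
    (hf : ∀ i, FactorsThroughSum C (f i)) : FactorsThroughSum C (∑ i ∈ s, f i) :=
  Finset.sum_induction f (FactorsThroughSum C) (fun _ _ => .add) .zero fun i _ => hf i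

/-- This allows several control objects to be replaced by their direct sum. -/
theorem FactorsThroughSum.of_retract {C' : ObjectProperty A} {f : X ⟶ Y}
    (h : ∀ D, C D → ∃ D', C' D' ∧ ∃ (r : D ⟶ D') (s : D' ⟶ D), r ≫ s = 𝟙 D)
    (hf : FactorsThroughSum C f) : FactorsThroughSum C' f := by
  obtain ⟨J, _, D, hD, a, b, rfl⟩ := (factorsThroughSum_iff _ _).1 hf
  choose D' hD' r s hrs using fun j => h (D j) (hD j)
  exact (factorsThroughSum_iff _ _).2 ⟨J, ‹_›, D', hD', fun j => a j ≫ r j, fun j => s j ≫ b j,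
    by simp [reassoc_of% hrs]⟩

/-- Suppose that the objects `obj V` of `A` are parametrized by the objects `V` of `𝒟`, and that
`Φ` is functorial on the full subcategory of the `obj V`, surjective on morphisms, and that its
kernel consists of the morphisms which factor through sums of copies of `I`. Then `𝒟` is
equivalent to a factor category `B/⟨I⟩`. -/
theorem exists_factorCategory_equivalence {𝒟 : Type v'} [Category.{w'} 𝒟] (I : A) (obj : 𝒟 → A)
    (Φ : ∀ {V W : 𝒟}, (obj V ⟶ obj W) → (V ⟶ W)) (hid : ∀ V, Φ (𝟙 (obj V)) = 𝟙 V)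
    (hcomp : ∀ {U V W : 𝒟} (f : obj U ⟶ obj V) (g : obj V ⟶ obj W), Φ (f ≫ g) = Φ f ≫ Φ g)
    (hsurj : ∀ {V W : 𝒟} (h : V ⟶ W), ∃ f : obj V ⟶ obj W, Φ f = h)
    (hker : ∀ {V W : 𝒟} (f g : obj V ⟶ obj W),
      Φ f = Φ g ↔ FactorsThroughSum (ObjectProperty.singleton I) (f - g))
    (Z : 𝒟) (hZ : ∀ f g : Z ⟶ Z, f = g) :
    ∃ B : ObjectProperty A, ObjectProperty.singleton I ≤ B ∧
      Nonempty (FactorCategory B (ObjectProperty.singleton I) ≌ 𝒟) := by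
  let B : ObjectProperty A := fun X => X = I ∨ ∃ V, X = obj V
  have hI : B I := Or.inl rfl
  have hobj : ∀ V, B (obj V) := fun V => Or.inr ⟨V, rfl⟩
  choose lift hlift using fun (V W : 𝒟) (h : V ⟶ W) => hsurj h
  let Q := Quotient.functor (modIdeal B (ObjectProperty.singleton I))
  let hom : ∀ {V W : 𝒟}, (obj V ⟶ obj W) →
      ((⟨obj V, hobj V⟩ : B.FullSubcategory) ⟶ ⟨obj W, hobj W⟩) := fun f => ObjectProperty.homMk f
  have hQ : ∀ {V W : 𝒟} (f g : obj V ⟶ obj W),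
      Q.map (hom f) = Q.map (hom g) ↔ Φ f = Φ g := fun f g => by
    rw [hker]
    exact Quotient.functor_map_eq_iff (modIdeal B (ObjectProperty.singleton I)) (hom f) (hom g)
  let F : 𝒟 ⥤ FactorCategory B (ObjectProperty.singleton I) :=
    { obj := fun V => Q.obj ⟨obj V, hobj V⟩
      map := fun {V W} h => Q.map (hom (lift V W h))
      map_id := fun V => by
        refine Eq.trans ?_ (Q.map_id _)
        refine (hQ (lift V V (𝟙 V)) (𝟙 (obj V))).2 ?_
        rw [hlift, hid]
      map_comp := fun {U V W} f g => by
        refine Eq.trans ?_ (Q.map_comp _ _)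
        refine (hQ (lift U W (f ≫ g)) (lift U V f ≫ lift V W g)).2 ?_
        rw [hlift, hcomp, hlift, hlift] }
  have : F.Faithful := ⟨fun {V W} f g h => by
    have := (hQ (lift V W f) (lift V W g)).1 h
    rwa [hlift, hlift] at this⟩
  have : F.Full := ⟨fun {V W} f => by
    obtain ⟨f, rfl⟩ := Q.map_surjective f
    refine ⟨Φ f.hom, ?_⟩
    exact (hQ (lift V W (Φ f.hom)) f.hom).2 (hlift _ _ _)⟩
  have : F.EssSurj := ⟨fun X => by
    obtain ⟨⟨X, hX⟩⟩ := X
    rcases hX with rfl | ⟨V, rfl⟩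
    -- Both `I` and the object of `Z` become zero in the factor category: the identity of `I`
    -- factors through `I`, and `Z` has only one endomorphism.
    · refine ⟨Z, ⟨⟨Q.map (ObjectProperty.homMk 0), Q.map (ObjectProperty.homMk 0), ?_, ?_⟩⟩⟩
      · refine (Q.map_comp _ _).symm.trans (Eq.trans ?_ (Q.map_id _))
        refine (hQ (0 ≫ 0) (𝟙 (obj Z))).2 (hZ _ _)
      · refine (Q.map_comp _ _).symm.trans (Eq.trans ?_ (Q.map_id _))
        refine (Quotient.functor_map_eq_iff (modIdeal B _) _ _).2 ?_
        exact FactorsThroughSum.of_prop ((ObjectProperty.singleton_iff _ _).2 rfl) _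
    · exact ⟨V, ⟨Iso.refl _⟩⟩⟩
  have : F.IsEquivalence := {}
  exact ⟨B, ObjectProperty.singleton_le_iff.2 hI, ⟨F.asEquivalence.symm⟩⟩

end ControlClass

/-! ### Cyclic control objects -/

namespace SubmodulePair

section Control

variable {R : Type u} [CommRing R] (c : Fin 3 → Fin 3 → R)
  (L : Type u) [AddCommGroup L] [Module R L] [Module.Finite R L]

/-- A matrix of scalars, as a matrix of endomorphisms of `L`. -/
def scalarRelations : Fin 3 → Fin 3 → Module.End R L := fun i j => c i j • LinearMap.id

/-- The direct sum, over a basis of `L`, of copies of the pair with three generators, of which the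
first generates the submodule, and with the matrix of relations `c`. -/
abbrev control : SubmodulePair R := presented (scalarRelations c L) {0}

variable {L}

/-- The `j`-th generator of a control object. -/
abbrev controlGen (j : Fin 3) : L →ₗ[R] (control c L).carrier := gen (scalarRelations c L) {0} j

theorem controlGen_relation (i : Fin 3) (v : L) : ∑ j, c i j • controlGen c j v = 0 := by
  simpa only [scalarRelations, LinearMap.smul_apply, LinearMap.id_apply, map_smul] using
    gen_relation (s := {0}) (ρ := scalarRelations c L) i v

theorem controlGen_zero_mem (v : L) : controlGen c 0 v ∈ (control c L).sub :=
  gen_mem_sub (Set.mem_singleton _) v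

variable {c}

theorem exists_eq_controlGen {x : (control c L).carrier} (hx : x ∈ (control c L).sub) :
    ∃ v : L, x = controlGen c 0 v := by
  obtain ⟨w, hw, rfl⟩ := mem_sub_presented.1 hx
  refine ⟨w 0, Finset.sum_eq_single 0 (fun j _ hj => ?_) fun h => absurd (Finset.mem_univ _) h⟩
  rw [hw j hj, map_zero]

theorem exists_eq_sum_controlGen (x : (control c L).carrier) :
    ∃ w : Fin 3 → L, x = ∑ j, controlGen c j (w j) :=
  exists_eq_sum_gen x

/-- A morphism out of a control object. -/
def controlDesc {N : SubmodulePair R} (e : Fin 3 → L →ₗ[R] N.carrier)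
    (he : ∀ i v, ∑ j, c i j • e j v = 0) (h0 : ∀ v, e 0 v ∈ N.sub) : control c L ⟶ N :=
  presentedDesc e (fun i v => by simpa [scalarRelations] using he i v)
    (by rintro j rfl v; exact h0 v)

@[simp]
theorem controlDesc_gen {N : SubmodulePair R} (e : Fin 3 → L →ₗ[R] N.carrier)
    (he : ∀ i v, ∑ j, c i j • e j v = 0) (h0 : ∀ v, e 0 v ∈ N.sub) (j : Fin 3) (v : L) :
    (controlDesc e he h0).toLinearMap (controlGen c j v) = e j v :=
  presentedDesc_gen _ _ _ _ _

variable (c)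

/-- Control objects are functorial in the module of coefficients. -/
def controlMap {L' : Type u} [AddCommGroup L'] [Module R L'] [Module.Finite R L']
    (g : L →ₗ[R] L') : control c L ⟶ control c L' :=
  controlDesc (fun j => controlGen c j ∘ₗ g) (fun i v => controlGen_relation c i (g v))
    fun v => controlGen_zero_mem c (g v)

variable {c}

/-- A basis of `L` writes the identity of `control c L` as a sum of maps through `control c R`.
Factorizations can thus be written without coordinates on `L`. -/
theorem factorsThroughSum_control [Module.Free R L] {M N : SubmodulePair R}
    {P : ObjectProperty (SubmodulePair R)} (hP : P (control c R)) (f : M ⟶ control c L)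
    (g : control c L ⟶ N) : FactorsThroughSum P (f ≫ g) := by
  let b := Module.Free.chooseBasis R L
  have hid : 𝟙 (control c L) =
      ∑ i, controlMap c (b.coord i) ≫ controlMap c (LinearMap.toSpanSingleton R L (b i)) := by
    refine presented_hom_ext fun j v => ?_
    refine Eq.trans ?_ (LinearMap.congr_fun (sum_toLinearMap Finset.univ _).symm _)
    rw [LinearMap.sum_apply]
    change controlGen c j v = ∑ i, (controlMap c (LinearMap.toSpanSingleton R L (b i))).toLinearMap
      ((controlMap c (b.coord i)).toLinearMap (controlGen c j v))
    simp only [controlMap, controlDesc_gen, LinearMap.comp_apply, ← map_sum]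
    congr 1
    simp [b.sum_repr v]
  have : f ≫ g = ∑ i, (f ≫ controlMap c (b.coord i)) ≫
      (controlMap c (LinearMap.toSpanSingleton R L (b i)) ≫ g) := by
    conv_lhs => rw [← Category.id_comp g, hid, Preadditive.sum_comp, Preadditive.comp_sum]
    simp only [Category.assoc]
  rw [this]
  exact .sum _ fun i => .comp_of_prop hP _ _

end Control

end SubmodulePair

/-! ### The pairs `model t φ τ` -/

namespace SubmodulePair

section Model

variable {R : Type u} [CommRing R] (t : R) {L : Type u} [AddCommGroup L] [Module R L]

/-- The elements of `L` which are annihilated by `t ^ i` are divisible by `t ^ (7 - i)`. -/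
def TorsionDivisible (L : Type*) [AddCommGroup L] [Module R L] : Prop :=
  ∀ i ≤ 7, ∀ v : L, t ^ i • v = 0 → ∃ w, v = t ^ (7 - i) • w

variable {t}

/-- Cancelling `t ^ i` costs an error divisible by `t ^ (7 - i)`, which is harmless as long as `j ≤
7`. -/
theorem TorsionDivisible.exists_of_pow_smul_eq (hL : TorsionDivisible t L) {i j : ℕ} (hij : i ≤ j)
    (hj : j ≤ 7) {v w : L} (h : t ^ i • v = t ^ j • w) : ∃ u, v = t ^ (j - i) • u := by
  have : t ^ i • (v - t ^ (j - i) • w) = 0 := by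
    rw [smul_sub, smul_smul, ← pow_add, h, Nat.add_sub_cancel' hij, sub_self]
  obtain ⟨u, hu⟩ := hL i (hij.trans hj) _ this
  refine ⟨w + t ^ (7 - j) • u, ?_⟩
  rw [smul_add, smul_smul, ← pow_add, show j - i + (7 - j) = 7 - i by omega, ← hu]
  abel

theorem TorsionDivisible.prod {L' : Type*} [AddCommGroup L'] [Module R L']
    (hL : TorsionDivisible t L) (hL' : TorsionDivisible t L') : TorsionDivisible t (L × L') :=
  fun i hi v hv => by
    obtain ⟨w, hw⟩ := hL i hi v.1 (congrArg Prod.fst hv)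
    obtain ⟨w', hw'⟩ := hL' i hi v.2 (congrArg Prod.snd hv)
    exact ⟨(w, w'), Prod.ext hw hw'⟩

theorem TorsionDivisible.pi {ι : Type*} {L : ι → Type*} [∀ i, AddCommGroup (L i)]
    [∀ i, Module R (L i)] (hL : ∀ i, TorsionDivisible t (L i)) :
    TorsionDivisible t (∀ i, L i) := fun i hi v hv => by
  choose w hw using fun j => hL j i hi (v j) (congrFun hv j)
  exact ⟨w, funext hw⟩

variable (t)

/-- The relations of `model`. -/
def modelRelations (φ τ : Module.End R L) : Fin 5 → Fin 5 → Module.End R L :=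
  ![![t ^ 4 • 1, 0, 0, 0, 0],
    ![0, t ^ 2 • 1, 0, 0, 0],
    ![-t • 1, -1, t ^ 2 • 1, 0, 0],
    ![-t ^ 2 • 1, 0, 0, t ^ 3 • 1, 0],
    ![-t ^ 2 • 1, -t • φ, 0, 0, t ^ 4 • τ]]

theorem sum_modelRelations {N : Type*} [AddCommGroup N] [Module R N] (φ τ : Module.End R L)
    (e : Fin 5 → L →ₗ[R] N) (v : L) :
    (∑ j, e j (modelRelations t φ τ 0 j v) = t ^ 4 • e 0 v) ∧
    (∑ j, e j (modelRelations t φ τ 1 j v) = t ^ 2 • e 1 v) ∧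
    (∑ j, e j (modelRelations t φ τ 2 j v) = t ^ 2 • e 2 v - (t • e 0 v + e 1 v)) ∧
    (∑ j, e j (modelRelations t φ τ 3 j v) = t ^ 3 • e 3 v - t ^ 2 • e 0 v) ∧
    (∑ j, e j (modelRelations t φ τ 4 j v) =
      t ^ 4 • e 4 (τ v) - (t ^ 2 • e 0 v + t • e 1 (φ v))) := by
  refine ⟨?_, ?_, ?_, ?_, ?_⟩ <;> simp [Fin.sum_univ_succ, modelRelations] <;> abel

variable [Module.Finite R L] (φ τ : Module.End R L)

/-- The pair with submodule `(R/t⁴ ⊗ L) ⊕ (R/t² ⊗ L)`, with generators `x v` and `y v`, in which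
the elements `t x v + y v`, `t² x v` and `t² x (φ v)`, `t y (φ v)` are made divisible by powers
of `t`. -/
abbrev model : SubmodulePair R := presented (modelRelations t φ τ) {0, 1}

/-- The generators of `model`. -/
abbrev modelGen (j : Fin 5) : L →ₗ[R] (model t φ τ).carrier := gen (modelRelations t φ τ) {0, 1} j

theorem model_relations (v : L) :
    t ^ 4 • modelGen t φ τ 0 v = 0 ∧ t ^ 2 • modelGen t φ τ 1 v = 0 ∧
    t ^ 2 • modelGen t φ τ 2 v = t • modelGen t φ τ 0 v + modelGen t φ τ 1 v ∧
    t ^ 3 • modelGen t φ τ 3 v = t ^ 2 • modelGen t φ τ 0 v ∧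
    t ^ 4 • modelGen t φ τ 4 (τ v) =
      t ^ 2 • modelGen t φ τ 0 v + t • modelGen t φ τ 1 (φ v) := by
  obtain ⟨s0, s1, s2, s3, s4⟩ := sum_modelRelations t φ τ (modelGen t φ τ) v
  have h : ∀ i, ∑ j, modelGen t φ τ j (modelRelations t φ τ i j v) = 0 := fun i => gen_relation i v
  exact ⟨s0.symm.trans (h 0), s1.symm.trans (h 1), sub_eq_zero.1 (s2.symm.trans (h 2)),
    sub_eq_zero.1 (s3.symm.trans (h 3)), sub_eq_zero.1 (s4.symm.trans (h 4))⟩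

variable {t φ τ}

theorem modelGen_zero_mem (v : L) : modelGen t φ τ 0 v ∈ (model t φ τ).sub :=
  gen_mem_sub (Or.inl rfl) v

theorem modelGen_one_mem (v : L) : modelGen t φ τ 1 v ∈ (model t φ τ).sub :=
  gen_mem_sub (Or.inr rfl) v

theorem exists_eq_model_sub {x : (model t φ τ).carrier} (hx : x ∈ (model t φ τ).sub) :
    ∃ p : L × L, x = modelGen t φ τ 0 p.1 + modelGen t φ τ 1 p.2 := by
  obtain ⟨w, hw, rfl⟩ := mem_sub_presented.1 hx
  refine ⟨(w 0, w 1), ?_⟩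
  rw [Fin.sum_univ_five, hw 2 (by simp), hw 3 (by simp), hw 4 (by simp)]
  simp

theorem model_eq_zero {w : Fin 5 → L} (h : ∑ j, modelGen t φ τ j (w j) = 0) :
    ∃ a b c d e : L, w 0 = t ^ 4 • a - t • c - t ^ 2 • d - t ^ 2 • e ∧
      w 1 = t ^ 2 • b - c - t • φ e ∧ w 2 = t ^ 2 • c ∧ w 3 = t ^ 3 • d ∧ w 4 = t ^ 4 • τ e := by
  obtain ⟨c, hc⟩ := sum_gen_eq_zero.1 h
  refine ⟨c 0, c 1, c 2, c 3, c 4, ?_, ?_, ?_, ?_, ?_⟩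
  · rw [hc]
    simp [Fin.sum_univ_succ, modelRelations]
    abel
  · rw [hc]
    simp [Fin.sum_univ_succ, modelRelations]
    abel
  · rw [hc]
    simp [Fin.sum_univ_succ, modelRelations]
  · rw [hc]
    simp [Fin.sum_univ_succ, modelRelations]
  · rw [hc]
    simp [Fin.sum_univ_succ, modelRelations]

/-- If an element of the submodule of `model` is divisible by `t ^ n`, it is, up to obvious
terms, a combination of the elements which were made divisible. -/
theorem model_eq_pow_smul {p q : L} {n : ℕ} {m : (model t φ τ).carrier}
    (h : modelGen t φ τ 0 p + modelGen t φ τ 1 q = t ^ n • m) :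
    ∃ a b c d e w₀ w₁ w₂ w₃ w₄ : L,
      p = t ^ 4 • a + t • c + t ^ 2 • d + t ^ 2 • e + t ^ n • w₀ ∧
      q = t ^ 2 • b + c + t • φ e + t ^ n • w₁ ∧ t ^ 2 • c = t ^ n • w₂ ∧
      t ^ 3 • d = t ^ n • w₃ ∧ t ^ 4 • τ e = t ^ n • w₄ := by
  obtain ⟨w, rfl⟩ := exists_eq_sum_gen m
  have h0 : ∑ j, modelGen t φ τ j ((![p, q, 0, 0, 0] - t ^ n • w : Fin 5 → L) j) = 0 := by
    simp only [Pi.sub_apply, Pi.smul_apply, map_sub, map_smul, Finset.sum_sub_distrib,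
      ← Finset.smul_sum]
    rw [← h, Fin.sum_univ_five]
    simp
  obtain ⟨a, b, c, d, e, h₀, h₁, h₂, h₃, h₄⟩ := model_eq_zero h0
  simp at h₀ h₁ h₂ h₃ h₄
  refine ⟨a, b, -c, -d, -e, w 0, w 1, w 2, w 3, w 4, ?_, ?_, ?_, ?_, ?_⟩
  · rw [sub_eq_iff_eq_add.1 h₀]
    simp only [smul_neg]
    abel
  · rw [sub_eq_iff_eq_add.1 h₁]
    simp only [smul_neg, map_neg]
    abel
  · rw [smul_neg, ← h₂, neg_neg]
  · rw [smul_neg, ← h₃, neg_neg]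
  · rw [map_neg, smul_neg, ← h₄, neg_neg]

/-- A morphism out of `model`. -/
def modelDesc {N : SubmodulePair R} (e : Fin 5 → L →ₗ[R] N.carrier)
    (h0 : ∀ v, t ^ 4 • e 0 v = 0) (h1 : ∀ v, t ^ 2 • e 1 v = 0)
    (h2 : ∀ v, t ^ 2 • e 2 v = t • e 0 v + e 1 v) (h3 : ∀ v, t ^ 3 • e 3 v = t ^ 2 • e 0 v)
    (h4 : ∀ v, t ^ 4 • e 4 (τ v) = t ^ 2 • e 0 v + t • e 1 (φ v))
    (m0 : ∀ v, e 0 v ∈ N.sub) (m1 : ∀ v, e 1 v ∈ N.sub) : model t φ τ ⟶ N :=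
  presentedDesc e (fun i v => by
    obtain ⟨s0, s1, s2, s3, s4⟩ := sum_modelRelations t φ τ e v
    fin_cases i
    · exact s0.trans (h0 v)
    · exact s1.trans (h1 v)
    · exact s2.trans (sub_eq_zero.2 (h2 v))
    · exact s3.trans (sub_eq_zero.2 (h3 v))
    · exact s4.trans (sub_eq_zero.2 (h4 v)))
    (by
      rintro j (rfl | rfl) v
      · exact m0 v
      · exact m1 v)

end Model

end SubmodulePair

/-! ### Morphisms between the pairs `model t φ τ` -/

namespace SubmodulePair

section ModelHom

variable {R : Type u} [CommRing R] {t : R} {L L' : Type u} [AddCommGroup L] [Module R L]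
  [AddCommGroup L'] [Module R L']

/-- Division by `s` is not unique, but projectivity allows the quotients to be chosen linearly. -/
theorem exists_eq_smul_linearMap [Module.Projective R L] {s : R} {g : L →ₗ[R] L'}
    (h : ∀ v, ∃ w, g v = s • w) : ∃ g₀ : L →ₗ[R] L', g = s • g₀ := by
  obtain ⟨g₀, hg₀⟩ := Module.projective_lifting_property
    (s • (LinearMap.id : L' →ₗ[R] L')).rangeRestrict
    (g.codRestrict (LinearMap.range (s • (LinearMap.id : L' →ₗ[R] L'))) fun v => by
      obtain ⟨w, hw⟩ := h v
      exact ⟨w, hw.symm⟩) (LinearMap.surjective_rangeRestrict _)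
  refine ⟨g₀, LinearMap.ext fun v => ?_⟩
  exact (congrArg Subtype.val (LinearMap.congr_fun hg₀ v)).symm

variable [Module.Finite R L] [Module.Finite R L'] {φ τ : Module.End R L} {φ' τ' : Module.End R L'}

theorem model_eq_sq_smul {p q : L} {m : (model t φ τ).carrier}
    (h : modelGen t φ τ 0 p + modelGen t φ τ 1 q = t ^ 2 • m) :
    ∃ c u v : L, p = t • c + t ^ 2 • u ∧ q = c + t • v := by
  obtain ⟨a, b, c, d, e, w₀, w₁, w₂, w₃, w₄, rfl, rfl, -, -, -⟩ := model_eq_pow_smul h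
  exact ⟨c, t ^ 2 • a + d + e + w₀, t • b + φ e + t • w₁, by module, by module⟩

/-- Divisibility by `t⁴` exceeds what the generators 2 and 3 provide, so their coefficients gain
extra factors of `t`; only the relation involving `φ` matters to leading order. -/
theorem model_eq_pow_four_smul (hL : TorsionDivisible t L) {p q : L} {m : (model t φ τ).carrier}
    (h : modelGen t φ τ 0 p + modelGen t φ τ 1 q = t ^ 4 • m) :
    ∃ e u v : L, p = t ^ 2 • e + t ^ 3 • u ∧ q = t • φ e + t ^ 2 • v := by
  obtain ⟨a, b, c, d, e, w₀, w₁, w₂, w₃, w₄, rfl, rfl, hc, hd, -⟩ := model_eq_pow_smul h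
  obtain ⟨c, rfl⟩ := hL.exists_of_pow_smul_eq (by norm_num) (by norm_num) hc
  obtain ⟨d, rfl⟩ := hL.exists_of_pow_smul_eq (by norm_num) (by norm_num) hd
  exact ⟨e, t • a + c + d + t • w₀, b + c + t ^ 2 • w₁, by module, by module⟩

/-- The fifth power detects the marking: the coefficient `e` is now forced to satisfy `τ e ∈ tL`. -/
theorem model_eq_pow_five_smul (hL : TorsionDivisible t L) {p q : L} {m : (model t φ τ).carrier}
    (h : modelGen t φ τ 0 p + modelGen t φ τ 1 q = t ^ 5 • m) :
    ∃ e u w : L, p = t ^ 2 • e + t ^ 3 • u ∧ τ e = t • w := by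
  obtain ⟨a, b, c, d, e, w₀, w₁, w₂, w₃, w₄, rfl, rfl, hc, hd, he⟩ := model_eq_pow_smul h
  obtain ⟨c, rfl⟩ := hL.exists_of_pow_smul_eq (by norm_num) (by norm_num) hc
  obtain ⟨d, rfl⟩ := hL.exists_of_pow_smul_eq (by norm_num) (by norm_num) hd
  obtain ⟨w, hw⟩ := hL.exists_of_pow_smul_eq (by norm_num) (by norm_num) he
  exact ⟨e, t • a + t • c + t • d + t ^ 2 • w₀, w, by module, by rw [hw, pow_one]⟩

/-- The submodule of `model` is a direct sum of copies of `R/t⁴` and `R/t²`. -/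
theorem model_sub_eq_zero (hL : TorsionDivisible t L) {σ : Module.End R L}
    (hσ : ∀ v, σ (τ v) = t • v) {p q : L}
    (h : modelGen t φ τ 0 p + modelGen t φ τ 1 q = 0) :
    (∃ p', p = t ^ 4 • p') ∧ ∃ q', q = t ^ 2 • q' := by
  -- Zero is treated as a multiple of `t⁷`, the largest exponent for which cancellation is
  -- available.
  obtain ⟨a, b, c, d, e, w₀, w₁, w₂, w₃, w₄, rfl, rfl, hc, hd, he⟩ :=
    model_eq_pow_smul (n := 7) (m := 0) (by rw [h, smul_zero])
  obtain ⟨c, rfl⟩ := hL.exists_of_pow_smul_eq (by norm_num) (by norm_num) hc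
  obtain ⟨d, rfl⟩ := hL.exists_of_pow_smul_eq (by norm_num) (by norm_num) hd
  obtain ⟨w, hw⟩ := hL.exists_of_pow_smul_eq (by norm_num) (by norm_num) he
  -- Since `σ ∘ τ` is multiplication by `t`, the map `τ` can be undone at the cost of one power of
  -- `t`.
  have he' : t ^ 1 • e = t ^ 3 • σ w := by rw [pow_one, ← hσ, hw, map_smul]
  obtain ⟨e, rfl⟩ := hL.exists_of_pow_smul_eq (by norm_num) (by norm_num) he'
  constructor
  · exact ⟨a + t ^ 2 • c + t ^ 2 • d + e + t ^ 3 • w₀, by module⟩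
  · refine ⟨b + t ^ 3 • c + t • φ e + t ^ 5 • w₁, ?_⟩
    rw [map_smul]
    module

/-- The action of a morphism on the submodules. -/
theorem exists_matrix [Module.Projective R L] (f : model t φ τ ⟶ model t φ' τ') :
    ∃ a b c d : L →ₗ[R] L',
      (∀ v, f.toLinearMap (modelGen t φ τ 0 v) =
        modelGen t φ' τ' 0 (a v) + modelGen t φ' τ' 1 (c v)) ∧
      (∀ v, f.toLinearMap (modelGen t φ τ 1 v) =
        modelGen t φ' τ' 0 (b v) + modelGen t φ' τ' 1 (d v)) := by
  let π : L' × L' →ₗ[R] (model t φ' τ').sub :=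
    ((modelGen t φ' τ' 0).coprod (modelGen t φ' τ' 1)).codRestrict _ fun p =>
      add_mem (modelGen_zero_mem p.1) (modelGen_one_mem p.2)
  have hπ : Function.Surjective π := fun x => by
    obtain ⟨p, hp⟩ := exists_eq_model_sub x.2
    exact ⟨p, Subtype.ext hp.symm⟩
  have key : ∀ g : L →ₗ[R] (model t φ τ).carrier, (∀ v, g v ∈ (model t φ τ).sub) →
      ∃ a c : L →ₗ[R] L', ∀ v, f.toLinearMap (g v) =
        modelGen t φ' τ' 0 (a v) + modelGen t φ' τ' 1 (c v) := fun g hg => by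
    obtain ⟨k, hk⟩ := Module.projective_lifting_property π
      ((f.toLinearMap ∘ₗ g).codRestrict _ fun v => f.apply_mem (hg v)) hπ
    exact ⟨LinearMap.fst R L' L' ∘ₗ k, LinearMap.snd R L' L' ∘ₗ k, fun v =>
      (congrArg Subtype.val (LinearMap.congr_fun hk v)).symm⟩
  obtain ⟨a, c, hac⟩ := key _ modelGen_zero_mem
  obtain ⟨b, d, hbd⟩ := key _ modelGen_one_mem
  exact ⟨a, b, c, d, hac, hbd⟩

variable {f : model t φ τ ⟶ model t φ' τ'} {a b c d : L →ₗ[R] L'}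

/-- The image of `y v` is killed by `t²`, whereas `x` generates copies of `R/t⁴`. -/
theorem matrix_dvd (hL' : TorsionDivisible t L') [Module.Projective R L] {σ' : Module.End R L'}
    (hσ : ∀ v, σ' (τ' v) = t • v)
    (hY : ∀ v, f.toLinearMap (modelGen t φ τ 1 v) =
        modelGen t φ' τ' 0 (b v) + modelGen t φ' τ' 1 (d v)) :
    ∃ b₀ : L →ₗ[R] L', b = t ^ 2 • b₀ := by
  refine exists_eq_smul_linearMap fun v => ?_
  have h := congrArg f.toLinearMap (model_relations t φ τ v).2.1
  rw [map_smul, hY, map_zero] at h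
  have h' : modelGen t φ' τ' 0 (t ^ 2 • b v) + modelGen t φ' τ' 1 (t ^ 2 • d v) = 0 := by
    rw [map_smul, map_smul, ← smul_add, h]
  obtain ⟨⟨p, hp⟩, -⟩ := model_sub_eq_zero hL' hσ h'
  obtain ⟨u, hu⟩ := hL'.exists_of_pow_smul_eq (by norm_num) (by norm_num) hp
  exact ⟨u, hu⟩

/-- The image of `t x v + y v` must again be divisible by `t²`. By `model_eq_sq_smul`, `a v` and `d
v` are then both congruent to the same element modulo `t`. -/
theorem matrix_diagonal (hL' : TorsionDivisible t L') {b₀ : L →ₗ[R] L'}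
    (hX : ∀ v, f.toLinearMap (modelGen t φ τ 0 v) =
        modelGen t φ' τ' 0 (a v) + modelGen t φ' τ' 1 (c v))
    (hY : ∀ v, f.toLinearMap (modelGen t φ τ 1 v) =
        modelGen t φ' τ' 0 ((t ^ 2 • b₀) v) + modelGen t φ' τ' 1 (d v)) (v : L) :
    ∃ w, d v = a v + t • w := by
  have h := congrArg f.toLinearMap (model_relations t φ τ v).2.2.1
  rw [map_smul, map_add, map_smul, hX, hY] at h
  have h' : modelGen t φ' τ' 0 (t • a v + t ^ 2 • b₀ v) + modelGen t φ' τ' 1 (t • c v + d v) =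
      t ^ 2 • f.toLinearMap (modelGen t φ τ 2 v) := by
    rw [h]
    simp only [map_add, map_smul, LinearMap.smul_apply]
    module
  obtain ⟨e, x, y, h1, h2⟩ := model_eq_sq_smul h'
  have h3 : t ^ 1 • (a v - e) = t ^ 2 • (x - b₀ v) := by
    linear_combination (norm := module) h1
  obtain ⟨z, hz⟩ := hL'.exists_of_pow_smul_eq (by norm_num) (by norm_num) h3
  exact ⟨y - c v - z, by linear_combination (norm := module) h2 - hz⟩

/-- The image of `t² x v + t y (φ v)` is divisible by `t⁴`, hence of the same shape for some `e`.
Modulo `t` this gives `a v = e` and `d (φ v) = φ' e`, and `d` may be replaced by `a`. -/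
theorem matrix_commute (hL' : TorsionDivisible t L') {b₀ : L →ₗ[R] L'}
    (hX : ∀ v, f.toLinearMap (modelGen t φ τ 0 v) =
        modelGen t φ' τ' 0 (a v) + modelGen t φ' τ' 1 (c v))
    (hY : ∀ v, f.toLinearMap (modelGen t φ τ 1 v) =
        modelGen t φ' τ' 0 ((t ^ 2 • b₀) v) + modelGen t φ' τ' 1 (d v))
    (hda : ∀ v, ∃ w, d v = a v + t • w) (v : L) :
    ∃ w, a (φ v) = φ' (a v) + t • w := by
  have h := congrArg f.toLinearMap (model_relations t φ τ v).2.2.2.2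
  rw [map_smul, map_add, map_smul, map_smul, hX, hY] at h
  have h' : modelGen t φ' τ' 0 (t ^ 2 • a v + t ^ 3 • b₀ (φ v)) +
      modelGen t φ' τ' 1 (t ^ 2 • c v + t • d (φ v)) =
      t ^ 4 • f.toLinearMap (modelGen t φ τ 4 (τ v)) := by
    rw [h]
    simp only [map_add, map_smul, LinearMap.smul_apply]
    module
  obtain ⟨e, x, y, h1, h2⟩ := model_eq_pow_four_smul hL' h'
  have h3 : t ^ 2 • (a v - e) = t ^ 3 • (x - b₀ (φ v)) := by
    linear_combination (norm := module) h1
  obtain ⟨z, hz⟩ := hL'.exists_of_pow_smul_eq (by norm_num) (by norm_num) h3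
  have h4 : t ^ 1 • (d (φ v) - φ' e) = t ^ 2 • (y - c v) := by
    linear_combination (norm := module) h2
  obtain ⟨z', hz'⟩ := hL'.exists_of_pow_smul_eq (by norm_num) (by norm_num) h4
  obtain ⟨w, hw⟩ := hda (φ v)
  have h5 : φ' (a v) = φ' e + t • φ' z := by
    rw [← map_smul, ← map_add]
    congr 1
    linear_combination (norm := module) hz
  exact ⟨z' - w - φ' z, by linear_combination (norm := module) hz' - hw - h5⟩

/-- For a marked `v`, the element `t² x v + t y (φ v)` and its image are divisible by `t⁵`, not only
by `t⁴`. -/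
theorem matrix_marked (hL' : TorsionDivisible t L') {b₀ : L →ₗ[R] L'}
    (hX : ∀ v, f.toLinearMap (modelGen t φ τ 0 v) =
        modelGen t φ' τ' 0 (a v) + modelGen t φ' τ' 1 (c v))
    (hY : ∀ v, f.toLinearMap (modelGen t φ τ 1 v) =
        modelGen t φ' τ' 0 ((t ^ 2 • b₀) v) + modelGen t φ' τ' 1 (d v)) {v w : L}
    (hv : τ v = t • w) : ∃ w', τ' (a v) = t • w' := by
  have h := congrArg f.toLinearMap (model_relations t φ τ v).2.2.2.2
  rw [hv, map_smul, map_smul, map_smul, map_add, map_smul, map_smul, hX, hY] at h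
  have h' : modelGen t φ' τ' 0 (t ^ 2 • a v + t ^ 3 • b₀ (φ v)) +
      modelGen t φ' τ' 1 (t ^ 2 • c v + t • d (φ v)) =
      t ^ 5 • f.toLinearMap (modelGen t φ τ 4 w) := by
    rw [show t ^ 5 = t ^ 4 * t by ring, mul_smul, h]
    simp only [map_add, map_smul, LinearMap.smul_apply]
    module
  obtain ⟨e, x, z, h1, h2⟩ := model_eq_pow_five_smul hL' h'
  have h3 : t ^ 2 • (a v - e) = t ^ 3 • (x - b₀ (φ v)) := by
    linear_combination (norm := module) h1
  obtain ⟨y, hy⟩ := hL'.exists_of_pow_smul_eq (by norm_num) (by norm_num) h3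
  refine ⟨z + τ' y, ?_⟩
  rw [smul_add, ← h2, ← map_smul, ← map_add]
  congr 1
  linear_combination (norm := module) hy

end ModelHom

end SubmodulePair

/-! ### Morphisms which factor through control objects -/

namespace SubmodulePair

section Factor

variable {R : Type u} [CommRing R] (t : R)

/-- The relations of the control object `(R/tⁱ, 0)`. -/
def zeroControl (i : ℕ) : Fin 3 → Fin 3 → R := ![![1, 0, 0], ![0, t ^ i, 0], ![0, 0, 1]]

/-- The relations of the control object `(R/tⁱ, R/tⁱ)`. -/
def fullControl (i : ℕ) : Fin 3 → Fin 3 → R := ![![t ^ i, 0, 0], ![0, 1, 0], ![0, 0, 1]]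

/-- The relations of the control object with submodule `R/t²`, generated by `z`, in which `t z` is
made divisible by `t²`. -/
def squareControl : Fin 3 → Fin 3 → R := ![![t ^ 2, 0, 0], ![t, -t ^ 2, 0], ![0, 0, 1]]

/-- The relations of the control object with submodule `R/t³`, generated by `z`, in which `t z` is
made divisible by `t²` and `t² z` by `t⁵`. -/
def cubeControl : Fin 3 → Fin 3 → R := ![![t ^ 3, 0, 0], ![t, -t ^ 2, 0], ![t ^ 2, 0, -t ^ 5]]

/-- The control matrices used for `model`. -/
def controlMatrix : Fin 8 → Fin 3 → Fin 3 → R :=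
  ![zeroControl t 2, zeroControl t 3, zeroControl t 4, zeroControl t 5, fullControl t 2,
    fullControl t 4, squareControl t, cubeControl t]

section Generators

variable {N : Type*} [AddCommGroup N] [Module R N]

theorem zeroControl_iff {i : ℕ} {x : Fin 3 → N} :
    (∀ k, ∑ j, zeroControl t i k j • x j = 0) ↔ x 0 = 0 ∧ t ^ i • x 1 = 0 ∧ x 2 = 0 := by
  simp [Fin.forall_fin_succ, Fin.sum_univ_three, zeroControl]

theorem fullControl_iff {i : ℕ} {x : Fin 3 → N} :
    (∀ k, ∑ j, fullControl t i k j • x j = 0) ↔ t ^ i • x 0 = 0 ∧ x 1 = 0 ∧ x 2 = 0 := by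
  simp [Fin.forall_fin_succ, Fin.sum_univ_three, fullControl]

theorem squareControl_iff {x : Fin 3 → N} :
    (∀ k, ∑ j, squareControl t k j • x j = 0) ↔
      t ^ 2 • x 0 = 0 ∧ t • x 0 = t ^ 2 • x 1 ∧ x 2 = 0 := by
  simp [Fin.forall_fin_succ, Fin.sum_univ_three, squareControl, ← sub_eq_add_neg, sub_eq_zero]

theorem cubeControl_iff {x : Fin 3 → N} :
    (∀ k, ∑ j, cubeControl t k j • x j = 0) ↔
      t ^ 3 • x 0 = 0 ∧ t • x 0 = t ^ 2 • x 1 ∧ t ^ 2 • x 0 = t ^ 5 • x 2 := by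
  simp [Fin.forall_fin_succ, Fin.sum_univ_three, cubeControl, ← sub_eq_add_neg, sub_eq_zero]

end Generators

section Generators

variable {L : Type u} [AddCommGroup L] [Module R L] [Module.Finite R L]

theorem zeroControl_gen (i : ℕ) (v : L) : controlGen (zeroControl t i) 0 v = 0 ∧
    t ^ i • controlGen (zeroControl t i) 1 v = 0 ∧ controlGen (zeroControl t i) 2 v = 0 :=
  (zeroControl_iff t).1 fun k => controlGen_relation (zeroControl t i) k v

theorem fullControl_gen (i : ℕ) (v : L) : t ^ i • controlGen (fullControl t i) 0 v = 0 ∧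
    controlGen (fullControl t i) 1 v = 0 ∧ controlGen (fullControl t i) 2 v = 0 :=
  (fullControl_iff t).1 fun k => controlGen_relation (fullControl t i) k v

theorem squareControl_gen (v : L) : t ^ 2 • controlGen (squareControl t) 0 v = 0 ∧
    t • controlGen (squareControl t) 0 v = t ^ 2 • controlGen (squareControl t) 1 v ∧
    controlGen (squareControl t) 2 v = 0 :=
  (squareControl_iff t).1 fun k => controlGen_relation (squareControl t) k v

theorem cubeControl_gen (v : L) : t ^ 3 • controlGen (cubeControl t) 0 v = 0 ∧
    t • controlGen (cubeControl t) 0 v = t ^ 2 • controlGen (cubeControl t) 1 v ∧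
    t ^ 2 • controlGen (cubeControl t) 0 v = t ^ 5 • controlGen (cubeControl t) 2 v :=
  (cubeControl_iff t).1 fun k => controlGen_relation (cubeControl t) k v

end Generators

theorem comp_apply {M N P : SubmodulePair R} (f : M ⟶ N) (g : N ⟶ P) (x : M.carrier) :
    (f ≫ g).toLinearMap x = g.toLinearMap (f.toLinearMap x) := rfl

variable {t}

/-- Multiplication by `t` on the image of the idempotent `ε`, and the identity on its kernel. -/
def marking {L : Type u} [AddCommGroup L] [Module R L] (t : R) (ε : Module.End R L) :
    Module.End R L := t • ε + (1 - ε)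

theorem marking_apply {L : Type u} [AddCommGroup L] [Module R L] (ε : Module.End R L) (v : L) :
    marking t ε v = t • ε v + (v - ε v) := rfl

/-- Exchanging the roles of image and kernel of `ε` supplies the missing factor `t`. -/
theorem marking_one_sub_marking {L : Type u} [AddCommGroup L] [Module R L] {ε : Module.End R L}
    (hε : ∀ v, ε (ε v) = ε v) (v : L) : marking t (1 - ε) (marking t ε v) = t • v := by
  simp only [marking_apply, LinearMap.sub_apply, Module.End.one_apply, map_add, map_sub, map_smul,
    hε]
  module

theorem modelDesc_gen {L : Type u} [AddCommGroup L] [Module R L] [Module.Finite R L]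
    {φ τ : Module.End R L} {N : SubmodulePair R} (e : Fin 5 → L →ₗ[R] N.carrier)
    (h0 h1 h2 h3 h4 m0 m1) (j : Fin 5) (v : L) :
    (modelDesc (t := t) (φ := φ) (τ := τ) e h0 h1 h2 h3 h4 m0 m1).toLinearMap
      (modelGen t φ τ j v) = e j v :=
  presentedDesc_gen _ _ _ _ _

variable {L L' : Type u} [AddCommGroup L] [Module R L] [AddCommGroup L'] [Module R L']
  [Module.Finite R L] [Module.Free R L] [Module.Finite R L']
  {φ τ ε : Module.End R L} {φ' τ' ε' : Module.End R L'}

variable {P : ObjectProperty (SubmodulePair R)}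

/-- Removes the entry `c` of the matrix. The map into `model` uses the difference of the generators
2 and 3, which makes `t y` divisible by `t³`; generator 3 is needed for this. -/
theorem exists_factor_squareControl (hP : P (control (squareControl t) R)) (w : L →ₗ[R] L') :
    ∃ f : model t φ τ ⟶ model t φ' τ', FactorsThroughSum P f ∧
      (∀ v, f.toLinearMap (modelGen t φ τ 0 v) = modelGen t φ' τ' 1 (w v)) ∧
      (∀ v, f.toLinearMap (modelGen t φ τ 1 v) = 0) := by
  have hz := fun v : L => (squareControl_gen t v).1
  have he := fun v : L => (squareControl_gen t v).2.1
  let z := controlGen (squareControl t) (L := L) 0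
  let g : model t φ τ ⟶ control (squareControl t) L :=
    modelDesc ![z, 0, controlGen (squareControl t) (L := L) 1, 0, 0]
      (fun v => by
        change (t ^ 4 • z v) = 0
        rw [pow_add t 2 2, mul_smul, hz, smul_zero])
      (fun v => by simp)
      (fun v => by
        change t ^ 2 • controlGen (squareControl t) (L := L) 1 v = t • z v + 0
        rw [add_zero, he])
      (fun v => by
        change t ^ 3 • 0 = t ^ 2 • z v
        rw [smul_zero, hz])
      (fun v => by
        change t ^ 4 • 0 = t ^ 2 • z v + t • 0
        rw [smul_zero, smul_zero, hz, add_zero])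
      (fun v => controlGen_zero_mem _ v)
      (fun v => zero_mem _)
  let h : control (squareControl t) L ⟶ model t φ' τ' :=
    controlDesc ![modelGen t φ' τ' 1 ∘ₗ w,
        t • (modelGen t φ' τ' 2 - modelGen t φ' τ' 3) ∘ₗ w, 0]
      (fun i v => by
        obtain ⟨-, hy, h2, h3, -⟩ := model_relations t φ' τ' (w v)
        refine (squareControl_iff t).2 ⟨hy, ?_, rfl⟩ i
        change t • modelGen t φ' τ' 1 (w v) =
          t ^ 2 • t • (modelGen t φ' τ' 2 (w v) - modelGen t φ' τ' 3 (w v))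
        linear_combination (norm := module) -(t • h2) + h3)
      (fun v => modelGen_one_mem (w v))
  have hg0 : ∀ v, g.toLinearMap (modelGen t φ τ 0 v) = z v := fun v =>
    modelDesc_gen _ _ _ _ _ _ _ _ _ _
  have hg1 : ∀ v, g.toLinearMap (modelGen t φ τ 1 v) = 0 := fun v =>
    modelDesc_gen _ _ _ _ _ _ _ _ _ _
  refine ⟨g ≫ h, factorsThroughSum_control hP g h, fun v => ?_, fun v => ?_⟩
  · rw [comp_apply, hg0]
    exact controlDesc_gen _ _ _ _ _
  · rw [comp_apply, hg1]
    exact map_zero _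

/-- Removes the part of `a` divisible by `t`. After multiplication by `t`, the term `t y (φ v)`
vanishes, so `t³ x w` is divisible by `t⁵` whether or not `w` is marked. -/
theorem exists_factor_cubeControl (hε : ∀ v, ε (ε v) = ε v)
    (hP : P (control (cubeControl t) R)) (w : L →ₗ[R] L') :
    ∃ f : model t φ (marking t ε) ⟶ model t φ' (marking t ε'), FactorsThroughSum P f ∧
      (∀ v, f.toLinearMap (modelGen t φ (marking t ε) 0 v) =
        t • modelGen t φ' (marking t ε') 0 (w v)) ∧
      (∀ v, f.toLinearMap (modelGen t φ (marking t ε) 1 v) = 0) := by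
  have hz := fun v : L => (cubeControl_gen t v).1
  have he := fun v : L => (cubeControl_gen t v).2.1
  have he' := fun v : L => (cubeControl_gen t v).2.2
  let z := controlGen (cubeControl t) (L := L) 0
  let e := controlGen (cubeControl t) (L := L) 1
  let e' := controlGen (cubeControl t) (L := L) 2
  let g : model t φ (marking t ε) ⟶ control (cubeControl t) L :=
    modelDesc ![z, 0, e, t ^ 2 • e', e' ∘ₗ marking t (1 - ε)]
      (fun v => by
        change t ^ 4 • z v = 0
        linear_combination (norm := module) t • hz v)
      (fun v => by simp)
      (fun v => by
        change t ^ 2 • e v = t • z v + 0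
        linear_combination (norm := module) -he v)
      (fun v => by
        change t ^ 3 • t ^ 2 • e' v = t ^ 2 • z v
        linear_combination (norm := module) -he' v)
      (fun v => by
        change t ^ 4 • e' (marking t (1 - ε) (marking t ε v)) = t ^ 2 • z v + t • 0
        rw [marking_one_sub_marking hε, map_smul]
        linear_combination (norm := module) -he' v)
      (fun v => controlGen_zero_mem _ v)
      (fun v => zero_mem _)
  let h : control (cubeControl t) L ⟶ model t φ' (marking t ε') :=
    controlDesc ![t • modelGen t φ' (marking t ε') 0 ∘ₗ w, modelGen t φ' (marking t ε') 0 ∘ₗ w,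
        modelGen t φ' (marking t ε') 4 ∘ₗ marking t ε' ∘ₗ w]
      (fun i v => by
        obtain ⟨hx, hy, -, -, h4⟩ := model_relations t φ' (marking t ε') (w v)
        have hy' := (model_relations t φ' (marking t ε') (φ' (w v))).2.1
        refine (cubeControl_iff t).2 ⟨?_, ?_, ?_⟩ i
        · change t ^ 3 • t • modelGen t φ' (marking t ε') 0 (w v) = 0
          linear_combination (norm := module) hx
        · change t • t • modelGen t φ' (marking t ε') 0 (w v) =
            t ^ 2 • modelGen t φ' (marking t ε') 0 (w v)
          module
        · change t ^ 2 • t • modelGen t φ' (marking t ε') 0 (w v) =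
            t ^ 5 • modelGen t φ' (marking t ε') 4 (marking t ε' (w v))
          linear_combination (norm := module) -(t • h4) - hy')
      (fun v => Submodule.smul_mem _ _ (modelGen_zero_mem (w v)))
  have hg0 : ∀ v, g.toLinearMap (modelGen t φ (marking t ε) 0 v) = z v := fun v =>
    modelDesc_gen _ _ _ _ _ _ _ _ _ _
  have hg1 : ∀ v, g.toLinearMap (modelGen t φ (marking t ε) 1 v) = 0 := fun v =>
    modelDesc_gen _ _ _ _ _ _ _ _ _ _
  refine ⟨g ≫ h, factorsThroughSum_control hP g h, fun v => ?_, fun v => ?_⟩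
  · rw [comp_apply, hg0]
    exact controlDesc_gen _ _ _ _ _
  · rw [comp_apply, hg1]
    exact map_zero _

/-- Removes the part of `d` divisible by `t`. The value on `x` is chosen so that `t x v + y v` goes
to zero. -/
theorem exists_factor_fullControl_two (hP : P (control (fullControl t 2) R)) (w : L →ₗ[R] L') :
    ∃ f : model t φ τ ⟶ model t φ' τ', FactorsThroughSum P f ∧
      (∀ v, f.toLinearMap (modelGen t φ τ 0 v) = -modelGen t φ' τ' 1 (w v)) ∧
      (∀ v, f.toLinearMap (modelGen t φ τ 1 v) = t • modelGen t φ' τ' 1 (w v)) := by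
  have hz := fun v : L => (fullControl_gen t 2 v).1
  let z := controlGen (fullControl t 2) (L := L) 0
  let g : model t φ τ ⟶ control (fullControl t 2) L :=
    modelDesc ![-z, t • z, 0, 0, 0]
      (fun v => by
        change t ^ 4 • -z v = 0
        linear_combination (norm := module) -(t ^ 2 • hz v))
      (fun v => by
        change t ^ 2 • t • z v = 0
        linear_combination (norm := module) t • hz v)
      (fun v => by
        change t ^ 2 • 0 = t • -z v + t • z v
        module)
      (fun v => by
        change t ^ 3 • 0 = t ^ 2 • -z v
        linear_combination (norm := module) hz v)
      (fun v => by
        change t ^ 4 • 0 = t ^ 2 • -z v + t • t • z (φ v)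
        linear_combination (norm := module) hz v - hz (φ v))
      (fun v => neg_mem (controlGen_zero_mem _ v))
      (fun v => Submodule.smul_mem _ _ (controlGen_zero_mem _ v))
  let h : control (fullControl t 2) L ⟶ model t φ' τ' :=
    controlDesc ![modelGen t φ' τ' 1 ∘ₗ w, 0, 0]
      (fun i v => (fullControl_iff t).2 ⟨(model_relations t φ' τ' (w v)).2.1, rfl, rfl⟩ i)
      (fun v => modelGen_one_mem (w v))
  have hh : ∀ v, h.toLinearMap (z v) = modelGen t φ' τ' 1 (w v) := fun v =>
    controlDesc_gen _ _ _ _ _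
  have hg0 : ∀ v, g.toLinearMap (modelGen t φ τ 0 v) = -z v := fun v =>
    modelDesc_gen _ _ _ _ _ _ _ _ _ _
  have hg1 : ∀ v, g.toLinearMap (modelGen t φ τ 1 v) = t • z v := fun v =>
    modelDesc_gen _ _ _ _ _ _ _ _ _ _
  refine ⟨g ≫ h, factorsThroughSum_control hP g h, fun v => ?_, fun v => ?_⟩
  · rw [comp_apply, hg0, map_neg, hh]
  · rw [comp_apply, hg1, map_smul, hh]

/-- Removes the entry `b`. The value on `x` is chosen so that `t² x v + t y (φ v)` goes to zero. -/
theorem exists_factor_fullControl_four (hP : P (control (fullControl t 4) R)) (w : L →ₗ[R] L') :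
    ∃ f : model t φ τ ⟶ model t φ' τ', FactorsThroughSum P f ∧
      (∀ v, f.toLinearMap (modelGen t φ τ 0 v) = -(t • modelGen t φ' τ' 0 (w (φ v)))) ∧
      (∀ v, f.toLinearMap (modelGen t φ τ 1 v) = t ^ 2 • modelGen t φ' τ' 0 (w v)) := by
  have hz := fun v : L => (fullControl_gen t 4 v).1
  let z := controlGen (fullControl t 4) (L := L) 0
  let g : model t φ τ ⟶ control (fullControl t 4) L :=
    modelDesc ![-(t • z ∘ₗ φ), t ^ 2 • z, z - z ∘ₗ φ, -(z ∘ₗ φ), 0]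
      (fun v => by
        change t ^ 4 • -(t • z (φ v)) = 0
        linear_combination (norm := module) -(t • hz (φ v)))
      (fun v => by
        change t ^ 2 • t ^ 2 • z v = 0
        linear_combination (norm := module) hz v)
      (fun v => by
        change t ^ 2 • (z v - z (φ v)) = t • -(t • z (φ v)) + t ^ 2 • z v
        module)
      (fun v => by
        change t ^ 3 • -z (φ v) = t ^ 2 • -(t • z (φ v))
        module)
      (fun v => by
        change t ^ 4 • 0 = t ^ 2 • -(t • z (φ v)) + t • t ^ 2 • z (φ v)
        module)
      (fun v => neg_mem (Submodule.smul_mem _ _ (controlGen_zero_mem _ (φ v))))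
      (fun v => Submodule.smul_mem _ _ (controlGen_zero_mem _ v))
  let h : control (fullControl t 4) L ⟶ model t φ' τ' :=
    controlDesc ![modelGen t φ' τ' 0 ∘ₗ w, 0, 0]
      (fun i v => (fullControl_iff t).2 ⟨(model_relations t φ' τ' (w v)).1, rfl, rfl⟩ i)
      (fun v => modelGen_zero_mem (w v))
  have hh : ∀ v, h.toLinearMap (z v) = modelGen t φ' τ' 0 (w v) := fun v =>
    controlDesc_gen _ _ _ _ _
  have hg0 : ∀ v, g.toLinearMap (modelGen t φ τ 0 v) = -(t • z (φ v)) := fun v =>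
    modelDesc_gen _ _ _ _ _ _ _ _ _ _
  have hg1 : ∀ v, g.toLinearMap (modelGen t φ τ 1 v) = t ^ 2 • z v := fun v =>
    modelDesc_gen _ _ _ _ _ _ _ _ _ _
  refine ⟨g ≫ h, factorsThroughSum_control hP g h, fun v => ?_, fun v => ?_⟩
  · rw [comp_apply, hg0, map_neg, map_smul, hh]
  · rw [comp_apply, hg1, map_smul, hh]

theorem exists_factor_zeroControl {i : ℕ} (hP : P (control (zeroControl t i) R))
    (e₂ e₃ e₄ : Module.End R L)
    (h₂ : ∀ v, t ^ 2 • controlGen (zeroControl t i) 1 (e₂ v) = 0)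
    (h₃ : ∀ v, t ^ 3 • controlGen (zeroControl t i) 1 (e₃ v) = 0)
    (h₄ : ∀ v, t ^ 4 • controlGen (zeroControl t i) 1 (e₄ (τ v)) = 0)
    {M : SubmodulePair R} (k : L →ₗ[R] M.carrier) (hk : ∀ v, t ^ i • k v = 0) :
    ∃ f : model t φ τ ⟶ M, FactorsThroughSum P f ∧
      ∀ j v, f.toLinearMap (modelGen t φ τ j v) = ![0, 0, k (e₂ v), k (e₃ v), k (e₄ v)] j := by
  let e := controlGen (zeroControl t i) (L := L) 1
  let g : model t φ τ ⟶ control (zeroControl t i) L :=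
    modelDesc ![0, 0, e ∘ₗ e₂, e ∘ₗ e₃, e ∘ₗ e₄] (fun v => by simp) (fun v => by simp)
      (fun v => (h₂ v).trans (by simp)) (fun v => (h₃ v).trans (by simp))
      (fun v => (h₄ v).trans (by simp)) (fun v => zero_mem _) (fun v => zero_mem _)
  let h : control (zeroControl t i) L ⟶ M :=
    controlDesc ![0, k, 0] (fun i v => (zeroControl_iff t).2 ⟨rfl, hk v, rfl⟩ i)
      (fun v => zero_mem _)
  have hh : ∀ v, h.toLinearMap (e v) = k v := fun v => controlDesc_gen _ _ _ _ _
  have hg : ∀ j v, g.toLinearMap (modelGen t φ τ j v) = _ := fun j v =>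
    modelDesc_gen _ _ _ _ _ _ _ _ j v
  refine ⟨g ≫ h, factorsThroughSum_control hP g h, fun j v => ?_⟩
  rw [comp_apply, hg]
  fin_cases j
  · exact map_zero _
  · exact map_zero _
  · exact hh _
  · exact hh _
  · exact hh _

/-- Such a map is defined on `M₀/M₁`, a direct sum of copies of `R/t²`, `R/t³`, `R/t⁴` and `R/t⁵`.
The last two come from generator 4 on the kernel and on the image of `ε`. -/
theorem factorsThroughSum_of_kills_sub (hε : ∀ v, ε (ε v) = ε v)
    (hP : ∀ i, P (control (controlMatrix t i) R)) {M : SubmodulePair R}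
    (f : model t φ (marking t ε) ⟶ M)
    (h0 : ∀ v, f.toLinearMap (modelGen t φ (marking t ε) 0 v) = 0)
    (h1 : ∀ v, f.toLinearMap (modelGen t φ (marking t ε) 1 v) = 0) : FactorsThroughSum P f := by
  have hE := fun (i : ℕ) (v : L) => (zeroControl_gen t i v).2.1
  have hrel : ∀ v, t ^ 2 • f.toLinearMap (modelGen t φ (marking t ε) 2 v) = 0 ∧
      t ^ 3 • f.toLinearMap (modelGen t φ (marking t ε) 3 v) = 0 ∧
      t ^ 4 • f.toLinearMap (modelGen t φ (marking t ε) 4 (marking t ε v)) = 0 := fun v => by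
    obtain ⟨-, -, r2, r3, r4⟩ := model_relations t φ (marking t ε) v
    refine ⟨?_, ?_, ?_⟩
    · rw [← map_smul, r2, map_add, map_smul, h0, h1, smul_zero, add_zero]
    · rw [← map_smul, r3, map_smul, h0, smul_zero]
    · rw [← map_smul, r4, map_add, map_smul, map_smul, h0, h1, smul_zero, smul_zero, add_zero]
  obtain ⟨f₂, hf₂, hf₂'⟩ := exists_factor_zeroControl (φ := φ) (τ := marking t ε) (hP 0)
    1 0 0 (hE 2) (fun v => by simp) (fun v => by simp)
    (f.toLinearMap ∘ₗ modelGen t φ (marking t ε) 2) (fun v => (hrel v).1)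
  obtain ⟨f₃, hf₃, hf₃'⟩ := exists_factor_zeroControl (φ := φ) (τ := marking t ε) (hP 1)
    0 1 0 (fun v => by simp) (hE 3) (fun v => by simp)
    (f.toLinearMap ∘ₗ modelGen t φ (marking t ε) 3) (fun v => (hrel v).2.1)
  obtain ⟨f₄, hf₄, hf₄'⟩ := exists_factor_zeroControl (φ := φ) (τ := marking t ε) (hP 2)
    0 0 (1 - ε) (fun v => by simp) (fun v => by simp) (fun v => hE 4 _)
    (f.toLinearMap ∘ₗ modelGen t φ (marking t ε) 4 ∘ₗ (1 - ε)) (fun v => by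
      have := (hrel (v - ε v)).2.2
      rwa [marking_apply, map_sub, hε, sub_self, smul_zero, zero_add, sub_zero] at this)
  obtain ⟨f₅, hf₅, hf₅'⟩ := exists_factor_zeroControl (φ := φ) (τ := marking t ε) (hP 3)
    0 0 ε (fun v => by simp) (fun v => by simp) (fun v => by
      have : ε (marking t ε v) = t • ε v := by
        rw [marking_apply, map_add, map_smul, map_sub, hε, sub_self, add_zero]
      rw [this, map_smul]
      linear_combination (norm := module) hE 5 (ε v))
    (f.toLinearMap ∘ₗ modelGen t φ (marking t ε) 4 ∘ₗ ε) (fun v => by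
      have := (hrel (ε v)).2.2
      rw [marking_apply, hε, sub_self, add_zero, map_smul, map_smul] at this
      change t ^ 5 • f.toLinearMap (modelGen t φ (marking t ε) 4 (ε v)) = 0
      linear_combination (norm := module) this)
  have : f = f₂ + f₃ + f₄ + f₅ := by
    refine presented_hom_ext fun j v => ?_
    change _ = f₂.toLinearMap (modelGen t φ (marking t ε) j v) +
      f₃.toLinearMap (modelGen t φ (marking t ε) j v) +
      f₄.toLinearMap (modelGen t φ (marking t ε) j v) +
      f₅.toLinearMap (modelGen t φ (marking t ε) j v)
    rw [hf₂', hf₃', hf₄', hf₅']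
    fin_cases j
    · exact (h0 v).trans (by simp)
    · exact (h1 v).trans (by simp)
    · simp
    · simp
    · simp only [Fin.reduceFinMk, Matrix.cons_val, LinearMap.comp_apply, LinearMap.zero_apply,
        map_zero, zero_add, LinearMap.sub_apply, Module.End.one_apply, map_sub, hε]
      module
  rw [this]
  exact ((hf₂.add hf₃).add hf₄).add hf₅

end Factor

end SubmodulePair

/-! ### The kernel of the action on `t³ M₁` -/

namespace SubmodulePair

section Kernel

variable {R : Type u} [CommRing R] {t : R}

section

variable {L L' : Type u} [AddCommGroup L] [Module R L] [AddCommGroup L'] [Module R L']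
  [Module.Finite R L] [Module.Finite R L']
  {φ ε : Module.End R L} {φ' ε' : Module.End R L'} {P : ObjectProperty (SubmodulePair R)}

theorem cube_smul_eq_zero_iff (hL : TorsionDivisible t L) (hε : ∀ v, ε (ε v) = ε v) {v : L} :
    t ^ 3 • modelGen t φ (marking t ε) 0 v = 0 ↔ ∃ w, v = t • w := by
  constructor
  · intro h
    obtain ⟨⟨p, hp⟩, -⟩ := model_sub_eq_zero (q := 0) hL (marking_one_sub_marking hε)
      (by rw [map_zero, add_zero, map_smul, h] : modelGen t φ (marking t ε) 0 (t ^ 3 • v) +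
        modelGen t φ (marking t ε) 1 0 = 0)
    obtain ⟨w, hw⟩ := hL.exists_of_pow_smul_eq (by norm_num) (by norm_num) hp
    exact ⟨w, by rw [hw, Nat.add_sub_cancel_left 3 1, pow_one]⟩
  · rintro ⟨w, rfl⟩
    rw [map_smul]
    linear_combination (norm := module) (model_relations t φ (marking t ε) w).1

theorem factorsThroughSum_of_kills [Module.Free R L] (hL' : TorsionDivisible t L')
    (hε : ∀ v, ε (ε v) = ε v) (hε' : ∀ v, ε' (ε' v) = ε' v)
    (hP : ∀ i, P (control (controlMatrix t i) R))
    (f : model t φ (marking t ε) ⟶ model t φ' (marking t ε'))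
    (hf : ∀ v, f.toLinearMap (t ^ 3 • modelGen t φ (marking t ε) 0 v) = 0) :
    FactorsThroughSum P f := by
  have hσ := marking_one_sub_marking (t := t) hε'
  obtain ⟨a, b, c, d, hX, hY⟩ := exists_matrix f
  obtain ⟨b₀, rfl⟩ := matrix_dvd hL' hσ hY
  have hda := matrix_diagonal hL' hX hY
  obtain ⟨a₁, rfl⟩ : ∃ a₁ : L →ₗ[R] L', a = t • a₁ := exists_eq_smul_linearMap fun v => by
    have h := hf v
    rw [map_smul, hX] at h
    have h' : modelGen t φ' (marking t ε') 0 (t ^ 3 • a v) +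
        modelGen t φ' (marking t ε') 1 (t ^ 3 • c v) = 0 := by
      rw [map_smul, map_smul, ← smul_add, h]
    obtain ⟨⟨p, hp⟩, -⟩ := model_sub_eq_zero hL' hσ h'
    obtain ⟨w, hw⟩ := hL'.exists_of_pow_smul_eq (by norm_num) (by norm_num) hp
    exact ⟨w, by rw [hw, Nat.add_sub_cancel_left 3 1, pow_one]⟩
  obtain ⟨d₁, rfl⟩ : ∃ d₁ : L →ₗ[R] L', d = t • d₁ := exists_eq_smul_linearMap fun v => by
    obtain ⟨w, hw⟩ := hda v
    exact ⟨a₁ v + w, by rw [hw, smul_add]; rfl⟩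
  -- The maps removing `b` and `d` also change the image of `x`; the summands `b₀ ∘ₗ φ` and `d₁` in
  -- the first two maps compensate for this.
  obtain ⟨f₁, hf₁, hX₁, hY₁⟩ := exists_factor_squareControl (φ := φ) (τ := marking t ε) (φ' := φ')
    (τ' := marking t ε') (hP 6) (c + d₁)
  obtain ⟨f₂, hf₂, hX₂, hY₂⟩ := exists_factor_cubeControl (φ := φ) (φ' := φ') (ε' := ε') hε
    (hP 7) (a₁ + b₀ ∘ₗ φ)
  obtain ⟨f₃, hf₃, hX₃, hY₃⟩ := exists_factor_fullControl_two (φ := φ) (τ := marking t ε)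
    (φ' := φ') (τ' := marking t ε') (hP 4) d₁
  obtain ⟨f₄, hf₄, hX₄, hY₄⟩ := exists_factor_fullControl_four (φ := φ) (τ := marking t ε)
    (φ' := φ') (τ' := marking t ε') (hP 5) b₀
  have happly : ∀ x, (f - (f₁ + f₂ + f₃ + f₄)).toLinearMap x = f.toLinearMap x -
      (f₁.toLinearMap x + f₂.toLinearMap x + f₃.toLinearMap x + f₄.toLinearMap x) := fun _ => rfl
  have h := factorsThroughSum_of_kills_sub hε hP (f - (f₁ + f₂ + f₃ + f₄))
    (fun v => by
      rw [happly, hX, hX₁, hX₂, hX₃, hX₄]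
      simp only [LinearMap.add_apply, LinearMap.smul_apply, LinearMap.comp_apply, map_add,
        map_smul]
      module)
    (fun v => by
      rw [happly, hY, hY₁, hY₂, hY₃, hY₄]
      simp only [LinearMap.smul_apply, map_smul]
      module)
  rw [← sub_add_cancel f (f₁ + f₂ + f₃ + f₄)]
  exact h.add (((hf₁.add hf₂).add hf₃).add hf₄)

/-- Morphisms from `model` to a control object vanish on `t³ M₁`. -/
theorem control_kills (i : Fin 8)
    (g : model t φ (marking t ε) ⟶ control (controlMatrix t i) R) (v : L) :
    g.toLinearMap (t ^ 3 • modelGen t φ (marking t ε) 0 v) = 0 := by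
  have hsub : (∀ r : R, t ^ 3 • controlGen (controlMatrix t i) 0 r = 0) →
      g.toLinearMap (t ^ 3 • modelGen t φ (marking t ε) 0 v) = 0 := fun h => by
    obtain ⟨r, hr⟩ := exists_eq_controlGen (g.apply_mem (modelGen_zero_mem v))
    rw [map_smul, hr, h]
  fin_cases i
  · exact hsub fun r => by
      change t ^ 3 • controlGen (zeroControl t 2) 0 r = 0
      rw [(zeroControl_gen t 2 r).1]
      exact smul_zero _
  · exact hsub fun r => by
      change t ^ 3 • controlGen (zeroControl t 3) 0 r = 0
      rw [(zeroControl_gen t 3 r).1]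
      exact smul_zero _
  · exact hsub fun r => by
      change t ^ 3 • controlGen (zeroControl t 4) 0 r = 0
      rw [(zeroControl_gen t 4 r).1]
      exact smul_zero _
  · exact hsub fun r => by
      change t ^ 3 • controlGen (zeroControl t 5) 0 r = 0
      rw [(zeroControl_gen t 5 r).1]
      exact smul_zero _
  · exact hsub fun r => by
      have := (fullControl_gen t 2 r).1
      change t ^ 3 • controlGen (fullControl t 2) 0 r = 0
      linear_combination (norm := module) t • this
  -- In `(R/t⁴, R/t⁴)` the submodule is not killed by `t³`. However, `t³ x v` is divisible by `t⁵`,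
  -- which kills the whole pair.
  · have h5 : t ^ 3 • modelGen t φ (marking t ε) 0 v =
        t ^ 5 • modelGen t φ (marking t ε) 4 (marking t ε v) := by
      obtain ⟨-, -, -, -, h⟩ := model_relations t φ (marking t ε) v
      have hy := (model_relations t φ (marking t ε) (φ v)).2.1
      linear_combination (norm := module) -(t • h) - hy
    rw [h5]
    obtain ⟨w, hw⟩ := exists_eq_sum_controlGen
      (g.toLinearMap (modelGen t φ (marking t ε) 4 (marking t ε v)))
    rw [map_smul, hw]
    change t ^ 5 • ∑ j, controlGen (fullControl t 4) j (w j) = 0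
    rw [Fin.sum_univ_three, (fullControl_gen t 4 (w 1)).2.1, (fullControl_gen t 4 (w 2)).2.2]
    linear_combination (norm := module) t • (fullControl_gen t 4 (w 0)).1
  · exact hsub fun r => by
      have := (squareControl_gen t r).1
      change t ^ 3 • controlGen (squareControl t) 0 r = 0
      linear_combination (norm := module) t • this
  · exact hsub fun r => (cubeControl_gen t r).1

/-- The control object. -/
def controlObject (t : R) : SubmodulePair R := pi fun i => control (controlMatrix t i) R

theorem kills_of_factorsThroughSum {M : SubmodulePair R}
    {f : model t φ (marking t ε) ⟶ M}
    (hf : FactorsThroughSum (ObjectProperty.singleton (controlObject t)) f) (v : L) :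
    f.toLinearMap (t ^ 3 • modelGen t φ (marking t ε) 0 v) = 0 := by
  obtain ⟨J, _, D, hD, g, h, rfl⟩ := (factorsThroughSum_iff _ _).1 hf
  rw [sum_toLinearMap, LinearMap.sum_apply]
  refine Finset.sum_eq_zero fun j _ => ?_
  have key : ∀ D : SubmodulePair R, controlObject t = D →
      ∀ g : model t φ (marking t ε) ⟶ D,
        g.toLinearMap (t ^ 3 • modelGen t φ (marking t ε) 0 v) = 0 := by
    rintro _ rfl g
    exact funext fun i => control_kills i
      (g ≫ (piBicone fun i => control (controlMatrix t i) R).π i) v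
  rw [comp_apply, key _ ((ObjectProperty.singleton_iff _ _).1 (hD j)), map_zero]

theorem factorsThroughSum_iff_kills [Module.Free R L] (hL' : TorsionDivisible t L')
    (hε : ∀ v, ε (ε v) = ε v) (hε' : ∀ v, ε' (ε' v) = ε' v)
    (f : model t φ (marking t ε) ⟶ model t φ' (marking t ε')) :
    FactorsThroughSum (ObjectProperty.singleton (controlObject t)) f ↔
      ∀ v, f.toLinearMap (t ^ 3 • modelGen t φ (marking t ε) 0 v) = 0 := by
  refine ⟨kills_of_factorsThroughSum, fun h => ?_⟩
  have := factorsThroughSum_of_kills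
    (P := ObjectProperty.ofObj fun i => control (controlMatrix t i) R) hL' hε hε'
    (fun i => ObjectProperty.ofObj_apply _ i) f h
  refine this.of_retract ?_
  rintro _ ⟨i⟩
  let B := piBicone fun i => control (controlMatrix t i) R
  exact ⟨_, (ObjectProperty.singleton_iff _ _).2 rfl, B.ι i, B.π i, (B.ι_π i i).trans (dif_pos rfl)⟩

end

/-! ### Two endomorphisms encoded by one endomorphism and a subspace -/

section Companion

variable {N N' : Type u} [AddCommGroup N] [Module R N] [AddCommGroup N'] [Module R N']

/-- The endomorphism `(v₁, v₂) ↦ (ξ v₁ + η v₂, v₁)`. -/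
def companion (ξ η : Module.End R N) : Module.End R (N × N) :=
  (ξ.coprod η).prod (LinearMap.fst R N N)

theorem companion_apply (ξ η : Module.End R N) (v : N × N) :
    companion ξ η v = (ξ v.1 + η v.2, v.1) := rfl

/-- The projection onto the first factor, as an idempotent. -/
def firstProj : Module.End R (N × N) := (LinearMap.inl R N N) ∘ₗ LinearMap.fst R N N

theorem firstProj_apply (v : N × N) : (firstProj : Module.End R (N × N)) v = (v.1, 0) := rfl

theorem firstProj_firstProj (v : N × N) : (firstProj : Module.End R (N × N))
    ((firstProj : Module.End R (N × N)) v) = (firstProj : Module.End R (N × N)) v := rfl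

theorem marking_firstProj (v : N × N) : marking t firstProj v = (t • v.1, v.2) := by
  simp [marking_apply, firstProj_apply]
  ext <;> simp

variable [Module.Finite R N] [Module.Finite R N']

/-- The pair attached to a module with two endomorphisms. -/
abbrev companionModel (t : R) (ξ η : Module.End R N) : SubmodulePair R :=
  model t (companion ξ η) (marking t firstProj)

/-- The elements of `t³ M₁`. -/
def top (t : R) (ξ η : Module.End R N) : N × N →ₗ[R] (companionModel t ξ η).carrier :=
  t ^ 3 • modelGen t (companion ξ η) (marking t firstProj) 0

variable {ξ η : Module.End R N} {ξ' η' : Module.End R N'}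

theorem top_eq_zero_iff (hN : TorsionDivisible t N) {v : N × N} :
    top t ξ η v = 0 ↔ ∃ w, v = t • w :=
  cube_smul_eq_zero_iff (hN.prod hN) firstProj_firstProj

theorem exists_companion_hom {p : N →ₗ[R] N'} (hξ : ∀ v, ∃ w, p (ξ v) = ξ' (p v) + t • w)
    (hη : ∀ v, ∃ w, p (η v) = η' (p v) + t • w) :
    ∃ f : companionModel t ξ η ⟶ companionModel t ξ' η',
      ∀ v, f.toLinearMap (top t ξ η v) = top t ξ' η' (p v.1, p v.2) := by
  let a : N × N →ₗ[R] N' × N' := p.prodMap p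
  let φ' := companion ξ' η'
  let τ' : Module.End R (N' × N') := marking t firstProj
  have ha : ∀ v, a (marking t firstProj v) = τ' (a v) := fun v => by
    simp only [a, τ', marking_firstProj, LinearMap.prodMap_apply, map_smul]
  refine ⟨modelDesc (fun j => modelGen t φ' τ' j ∘ₗ a)
    (fun v => (model_relations t φ' τ' (a v)).1) (fun v => (model_relations t φ' τ' (a v)).2.1)
    (fun v => (model_relations t φ' τ' (a v)).2.2.1)
    (fun v => (model_relations t φ' τ' (a v)).2.2.2.1) (fun v => ?_)
    (fun v => modelGen_zero_mem _) (fun v => modelGen_one_mem _), fun v => ?_⟩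
  · change t ^ 4 • modelGen t φ' τ' 4 (a (marking t firstProj v)) =
      t ^ 2 • modelGen t φ' τ' 0 (a v) + t • modelGen t φ' τ' 1 (a (companion ξ η v))
    obtain ⟨w, hw⟩ := hξ v.1
    obtain ⟨w', hw'⟩ := hη v.2
    -- The map `p × p` commutes with the companion endomorphisms only modulo `t`; the error enters
    -- through `t y`, and `t² y = 0`.
    have h1 : a (companion ξ η v) = φ' (a v) + t • (w + w', 0) := by
      simp only [a, φ', companion_apply, LinearMap.prodMap_apply, map_add, hw, hw']
      ext
      · simp only [Prod.fst_add, Prod.smul_fst]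
        module
      · simp
    rw [ha, (model_relations t φ' τ' (a v)).2.2.2.2, h1, map_add, map_smul]
    linear_combination (norm := module) -(model_relations t φ' τ' (w + w', 0)).2.1
  · exact (map_smul _ _ _).trans (congrArg (t ^ 3 • ·) (modelDesc_gen _ _ _ _ _ _ _ _ 0 v))

/-- Modulo `t`, the marking gives `a (v, 0) = (p v, 0)`. Commutation at `(v, 0)` then determines `a
(0, v)`, and commutation at `(0, v)` gives both intertwining relations, whence `a = p × p`. -/
theorem exists_top_eq [Module.Free R N] (hN : TorsionDivisible t N')
    (f : companionModel t ξ η ⟶ companionModel t ξ' η') :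
    ∃ p : N →ₗ[R] N', (∀ v, ∃ w, p (ξ v) = ξ' (p v) + t • w) ∧
      (∀ v, ∃ w, p (η v) = η' (p v) + t • w) ∧
      ∀ v, f.toLinearMap (top t ξ η v) = top t ξ' η' (p v.1, p v.2) := by
  have hL := hN.prod hN
  have hσ := marking_one_sub_marking (t := t) (firstProj_firstProj (R := R) (N := N'))
  obtain ⟨a, b, c, d, hX, hY⟩ := exists_matrix f
  obtain ⟨b₀, rfl⟩ := matrix_dvd hL hσ hY
  have hcomm := matrix_commute hL hX hY (matrix_diagonal hL hX hY)
  let p : N →ₗ[R] N' := LinearMap.fst R N' N' ∘ₗ a ∘ₗ LinearMap.inl R N N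
  have hr : ∀ v, ∃ w, a (v, 0) = (p v, t • w) := fun v => by
    obtain ⟨w, hw⟩ := matrix_marked (v := (v, 0)) (w := (v, 0)) hL hX hY
      (by rw [marking_firstProj]; ext <;> simp)
    rw [marking_firstProj] at hw
    have hw2 : (a (v, 0)).2 = t • w.2 := congrArg Prod.snd hw
    exact ⟨w.2, Prod.ext rfl hw2⟩
  have hs : ∀ v, ∃ w w', a (0, v) = (ξ' (p v) - p (ξ v) + t • w, p v + t • w') := fun v => by
    obtain ⟨w, hw⟩ := hcomm (v, 0)
    obtain ⟨x, hx⟩ := hr v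
    obtain ⟨y, hy⟩ := hr (ξ v)
    have h1 : companion ξ η (v, 0) = (ξ v, 0) + (0, v) := by simp [companion_apply]
    rw [h1, map_add, hx, hy, companion_apply] at hw
    have e1 := congrArg Prod.fst hw
    have e2 := congrArg Prod.snd hw
    simp only [Prod.fst_add, Prod.snd_add, Prod.smul_fst, Prod.smul_snd, map_smul] at e1 e2
    refine ⟨η' x + w.1, w.2 - y, Prod.ext ?_ ?_⟩
    · linear_combination (norm := module) e1
    · linear_combination (norm := module) e2
  have hq : ∀ v, (∃ w, p (ξ v) = ξ' (p v) + t • w) ∧ ∃ w, p (η v) = η' (p v) + t • w := fun v => by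
    obtain ⟨w, hw⟩ := hcomm (0, v)
    obtain ⟨x, y, hxy⟩ := hs v
    obtain ⟨z, hz⟩ := hr (η v)
    have h1 : companion ξ η (0, v) = (η v, 0) := by simp [companion_apply]
    rw [h1, hz, hxy, companion_apply] at hw
    have e1 := congrArg Prod.fst hw
    have e2 := congrArg Prod.snd hw
    simp only [Prod.fst_add, Prod.snd_add, Prod.smul_fst, Prod.smul_snd] at e1 e2
    have e3 : p (ξ v) = ξ' (p v) + t • (x + w.2 - z) := by
      linear_combination (norm := module) e2
    refine ⟨⟨_, e3⟩, ξ' (z - w.2) + η' y + w.1, ?_⟩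
    have e4 : ξ' (p v) - p (ξ v) + t • x = t • (z - w.2) := by
      linear_combination (norm := module) -e3
    rw [e4, map_add, map_smul, map_smul] at e1
    linear_combination (norm := module) e1
  refine ⟨p, fun v => (hq v).1, fun v => (hq v).2, fun v => ?_⟩
  obtain ⟨x, hx⟩ := hr v.1
  obtain ⟨y, z, hyz⟩ := hs v.2
  obtain ⟨s, hs⟩ := (hq v.2).1
  have ha : a v = (p v.1, p v.2) + t • (y - s, x + z) := by
    have hv : v = (v.1, 0) + (0, v.2) := by simp
    rw [hv, map_add, hx, hyz]
    refine Prod.ext ?_ ?_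
    · simp only [Prod.fst_add, Prod.smul_fst, add_zero]
      linear_combination (norm := module) -hs
    · simp only [Prod.snd_add, Prod.smul_snd, zero_add]
      module
  change f.toLinearMap (t ^ 3 • modelGen t (companion ξ η) (marking t firstProj) 0 v) =
    t ^ 3 • modelGen t (companion ξ' η') (marking t firstProj) 0 (p v.1, p v.2)
  -- The error terms vanish after multiplication by `t³`, because `t⁴ x = 0` and `t² y = 0`.
  rw [map_smul, hX, ha, map_add, map_smul]
  linear_combination (norm := module)
    (model_relations t (companion ξ' η') (marking t firstProj) (y - s, x + z)).1 +
    t • (model_relations t (companion ξ' η') (marking t firstProj) (c v)).2.1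

end Companion

end Kernel

end SubmodulePair

/-! ### Lifting modules over the residue field -/

namespace SubmodulePair

section Lift

open IsLocalRing

variable {R : Type u} [CommRing R] [IsLocalRing R]

section

variable (V : Type u) [AddCommGroup V] [Module (ResidueField R) V]
  {W : Type u} [AddCommGroup W] [Module (ResidueField R) W]

/-- The free module of the same rank as `V`. -/
abbrev Cover : Type u := Fin (Module.finrank (ResidueField R) V) → R

variable [Module.Finite (ResidueField R) V] [Module.Finite (ResidueField R) W]

/-- The projective cover of `V`. -/
noncomputable def coverMap : Cover (R := R) V →ₛₗ[residue R] V where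
  toFun v := ∑ i, residue R (v i) • Module.finBasis (ResidueField R) V i
  map_add' v w := by
    simp [add_smul, Finset.sum_add_distrib]
  map_smul' r v := by
    simp [mul_smul, Finset.smul_sum]

theorem coverMap_apply (v : Cover (R := R) V) :
    coverMap V v = ∑ i, residue R (v i) • Module.finBasis (ResidueField R) V i := rfl

theorem coverMap_surjective : Function.Surjective (coverMap (R := R) V) := fun x => by
  choose v hv using fun i => residue_surjective ((Module.finBasis (ResidueField R) V).repr x i)
  refine ⟨v, ?_⟩
  rw [coverMap_apply]
  simp only [hv]
  exact (Module.finBasis (ResidueField R) V).sum_repr x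

variable {V}

theorem coverMap_eq_zero_iff {t : R} (ht : maximalIdeal R = Ideal.span {t})
    {v : Cover (R := R) V} : coverMap V v = 0 ↔ ∃ w, v = t • w := by
  have hmem : ∀ r : R, residue R r = 0 ↔ ∃ s, r = t * s := fun r => by
    rw [residue_eq_zero_iff, ht, Ideal.mem_span_singleton]
    rfl
  constructor
  · intro h
    have h0 := Fintype.linearIndependent_iff.1
      (Module.finBasis (ResidueField R) V).linearIndependent _ h
    choose w hw using fun i => (hmem _).1 (h0 i)
    exact ⟨w, funext hw⟩
  · rintro ⟨w, rfl⟩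
    rw [LinearMap.map_smulₛₗ, (hmem t).2 ⟨1, (mul_one t).symm⟩, zero_smul]

theorem coverMap_eq_iff {t : R} (ht : maximalIdeal R = Ideal.span {t})
    {v v' : Cover (R := R) V} : coverMap V v = coverMap V v' ↔ ∃ w, v = v' + t • w := by
  rw [← sub_eq_zero, ← map_sub, coverMap_eq_zero_iff ht]
  exact exists_congr fun w => sub_eq_iff_eq_add'

theorem exists_cover_lift (g : V →ₗ[ResidueField R] W) :
    ∃ p : Cover (R := R) V →ₗ[R] Cover (R := R) W, ∀ v, coverMap W (p v) = g (coverMap V v) := by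
  choose u hu using fun i => coverMap_surjective (R := R) W
    (g (Module.finBasis (ResidueField R) V i))
  refine ⟨Fintype.linearCombination R u, fun v => ?_⟩
  rw [Fintype.linearCombination_apply, coverMap_apply V, map_sum, map_sum]
  exact Finset.sum_congr rfl fun i _ => by rw [LinearMap.map_smulₛₗ, hu, map_smul]

theorem exists_cover_descent (p : Cover (R := R) V →ₗ[R] Cover (R := R) W) :
    ∃ g : V →ₗ[ResidueField R] W, ∀ v, coverMap W (p v) = g (coverMap V v) := by
  refine ⟨(Module.finBasis (ResidueField R) V).constr (ResidueField R)
    fun i => coverMap W (p (Pi.single i 1)), fun v => ?_⟩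
  rw [coverMap_apply V, map_sum]
  simp only [map_smul, Module.Basis.constr_basis]
  conv_lhs => rw [pi_eq_sum_univ' v, map_sum, map_sum]
  refine Finset.sum_congr rfl fun i _ => ?_
  rw [map_smul, LinearMap.map_smulₛₗ]

end

section

variable {V W U : Type u} [AddCommGroup V] [Module (ResidueField R) V]
  [AddCommGroup W] [Module (ResidueField R) W] [AddCommGroup U] [Module (ResidueField R) U]
  [Module.Finite (ResidueField R) V] [Module.Finite (ResidueField R) W]
  [Module.Finite (ResidueField R) U] {t : R}

/-- The morphism `f` acts on `t³ M₁`, which is isomorphic to `V × V`, as `h × h`. -/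
def Induces {ξ η : Module.End R (Cover (R := R) V)} {ξ' η' : Module.End R (Cover (R := R) W)}
    (f : companionModel t ξ η ⟶ companionModel t ξ' η') (h : V → W) : Prop :=
  ∀ v w, coverMap W (Prod.fst w) = h (coverMap V (Prod.fst v)) →
    coverMap W (Prod.snd w) = h (coverMap V (Prod.snd v)) →
    f.toLinearMap (top t ξ η v) = top t ξ' η' w

variable {ξ η : Module.End R (Cover (R := R) V)} {ξ' η' : Module.End R (Cover (R := R) W)}
  {ξ'' η'' : Module.End R (Cover (R := R) U)}

theorem top_eq_top_iff (ht : maximalIdeal R = Ideal.span {t}) (hR : TorsionDivisible t R)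
    {v v' : Cover (R := R) V × Cover (R := R) V} : top t ξ η v = top t ξ η v' ↔
      coverMap V v.1 = coverMap V v'.1 ∧ coverMap V v.2 = coverMap V v'.2 := by
  rw [← sub_eq_zero, ← map_sub, top_eq_zero_iff (.pi fun _ => hR), coverMap_eq_iff ht,
    coverMap_eq_iff ht]
  constructor
  · rintro ⟨w, hw⟩
    exact ⟨⟨w.1, sub_eq_iff_eq_add'.1 (congrArg Prod.fst hw)⟩,
      ⟨w.2, sub_eq_iff_eq_add'.1 (congrArg Prod.snd hw)⟩⟩
  · rintro ⟨⟨w, hw⟩, w', hw'⟩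
    exact ⟨(w, w'), Prod.ext (sub_eq_iff_eq_add'.2 hw) (sub_eq_iff_eq_add'.2 hw')⟩

theorem Induces.id (ht : maximalIdeal R = Ideal.span {t}) (hR : TorsionDivisible t R) :
    Induces (𝟙 (companionModel t ξ η)) (id : V → V) := fun _ _ h1 h2 =>
  (top_eq_top_iff ht hR).2 ⟨h1.symm, h2.symm⟩

theorem Induces.comp {f : companionModel t ξ η ⟶ companionModel t ξ' η'}
    {g : companionModel t ξ' η' ⟶ companionModel t ξ'' η''} {h : V → W} {k : W → U}
    (hf : Induces f h) (hg : Induces g k) : Induces (f ≫ g) (k ∘ h) := fun v w h1 h2 => by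
  obtain ⟨x, hx⟩ := coverMap_surjective (R := R) W (h (coverMap V v.1))
  obtain ⟨y, hy⟩ := coverMap_surjective (R := R) W (h (coverMap V v.2))
  rw [comp_apply, hf v (x, y) hx hy]
  exact hg _ _ (by rw [h1, hx]; rfl) (by rw [h2, hy]; rfl)

/-- Both sides say that `f` and `g` agree on `t³ M₁`. -/
theorem Induces.eq_iff (ht : maximalIdeal R = Ideal.span {t}) (hR : TorsionDivisible t R)
    {f g : companionModel t ξ η ⟶ companionModel t ξ' η'} {h k : V → W}
    (hf : Induces f h) (hg : Induces g k) :
    h = k ↔ FactorsThroughSum (ObjectProperty.singleton (controlObject t)) (f - g) := by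
  have hN : TorsionDivisible t (Cover (R := R) W) := .pi fun _ => hR
  rw [factorsThroughSum_iff_kills (hN.prod hN) firstProj_firstProj firstProj_firstProj]
  have hsub : (∀ v, (f - g).toLinearMap
      (t ^ 3 • modelGen t (companion ξ η) (marking t firstProj) 0 v) = 0) ↔
      ∀ v, f.toLinearMap (top t ξ η v) = g.toLinearMap (top t ξ η v) :=
    forall_congr' fun v => sub_eq_zero (a := f.toLinearMap (top t ξ η v))
  rw [hsub]
  constructor
  · rintro rfl v
    obtain ⟨x, hx⟩ := coverMap_surjective (R := R) W (h (coverMap V v.1))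
    obtain ⟨y, hy⟩ := coverMap_surjective (R := R) W (h (coverMap V v.2))
    rw [hf v (x, y) hx hy, hg v (x, y) hx hy]
  · intro hfg
    funext x
    obtain ⟨v, rfl⟩ := coverMap_surjective (R := R) V x
    obtain ⟨x, hx⟩ := coverMap_surjective (R := R) W (h (coverMap V v))
    obtain ⟨y, hy⟩ := coverMap_surjective (R := R) W (k (coverMap V v))
    have := hfg (v, v)
    rw [hf (v, v) (x, x) hx hx, hg (v, v) (y, y) hy hy, top_eq_top_iff ht hR] at this
    rw [← hx, ← hy, this.1]

theorem exists_induces (ht : maximalIdeal R = Ideal.span {t}) (hR : TorsionDivisible t R)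
    {X Y : Module.End (ResidueField R) V} {X' Y' : Module.End (ResidueField R) W}
    (hξ : ∀ v, coverMap V (ξ v) = X (coverMap V v)) (hη : ∀ v, coverMap V (η v) = Y (coverMap V v))
    (hξ' : ∀ v, coverMap W (ξ' v) = X' (coverMap W v))
    (hη' : ∀ v, coverMap W (η' v) = Y' (coverMap W v))
    (f : companionModel t ξ η ⟶ companionModel t ξ' η') :
    ∃ h : V →ₗ[ResidueField R] W, (∀ x, h (X x) = X' (h x)) ∧ (∀ x, h (Y x) = Y' (h x)) ∧
      Induces f h := by
  obtain ⟨p, hpξ, hpη, hp⟩ := exists_top_eq (.pi fun _ => hR) f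
  obtain ⟨h, hh⟩ := exists_cover_descent p
  refine ⟨h, fun x => ?_, fun x => ?_, fun v w h1 h2 => ?_⟩
  · obtain ⟨v, rfl⟩ := coverMap_surjective (R := R) V x
    rw [← hξ, ← hh, ← hh, ← hξ', coverMap_eq_iff ht]
    exact hpξ v
  · obtain ⟨v, rfl⟩ := coverMap_surjective (R := R) V x
    rw [← hη, ← hh, ← hh, ← hη', coverMap_eq_iff ht]
    exact hpη v
  · rw [hp, top_eq_top_iff ht hR]
    exact ⟨by rw [hh, h1], by rw [hh, h2]⟩

theorem exists_induces_of_linearMap (ht : maximalIdeal R = Ideal.span {t})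
    (hR : TorsionDivisible t R)
    {X Y : Module.End (ResidueField R) V} {X' Y' : Module.End (ResidueField R) W}
    (hξ : ∀ v, coverMap V (ξ v) = X (coverMap V v)) (hη : ∀ v, coverMap V (η v) = Y (coverMap V v))
    (hξ' : ∀ v, coverMap W (ξ' v) = X' (coverMap W v))
    (hη' : ∀ v, coverMap W (η' v) = Y' (coverMap W v))
    (h : V →ₗ[ResidueField R] W) (hX : ∀ x, h (X x) = X' (h x)) (hY : ∀ x, h (Y x) = Y' (h x)) :
    ∃ f : companionModel t ξ η ⟶ companionModel t ξ' η', Induces f h := by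
  obtain ⟨p, hp⟩ := exists_cover_lift (R := R) h
  obtain ⟨f, hf⟩ := exists_companion_hom (t := t) (ξ := ξ) (η := η) (ξ' := ξ') (η' := η') (p := p)
    (fun v => (coverMap_eq_iff ht).1 (by rw [hp, hξ, hX, hξ', hp]))
    (fun v => (coverMap_eq_iff ht).1 (by rw [hp, hη, hY, hη', hp]))
  refine ⟨f, fun v w h1 h2 => ?_⟩
  rw [hf, top_eq_top_iff ht hR]
  exact ⟨by rw [hp, h1], by rw [hp, h2]⟩

end

end Lift

end SubmodulePair

/-! ### Linearity over the free algebra -/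

section FreeAlgebra

/-- A `k`-linear map which commutes with the generators is linear over the free algebra. -/
def LinearMap.ofFreeAlgebra {k ι V W : Type*} [CommRing k] [AddCommGroup V] [Module k V]
    [Module (FreeAlgebra k ι) V] [IsScalarTower k (FreeAlgebra k ι) V] [AddCommGroup W] [Module k W]
    [Module (FreeAlgebra k ι) W] [IsScalarTower k (FreeAlgebra k ι) W] (h : V →ₗ[k] W)
    (hh : ∀ (i : ι) (x : V), h (FreeAlgebra.ι k i • x) = FreeAlgebra.ι k i • h x) :
    V →ₗ[FreeAlgebra k ι] W where
  toFun := h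
  map_add' := map_add h
  map_smul' a := by
    induction a with
    | grade0 r => intro x; simp [algebraMap_smul]
    | grade1 i => exact hh i
    | mul a b ha hb => intro x; simp only [mul_smul, RingHom.id_apply] at *; rw [ha, hb]
    | add a b ha hb => intro x; simp only [add_smul, map_add, RingHom.id_apply] at *; rw [ha, hb]

end FreeAlgebra

namespace SubmodulePair

open IsLocalRing

open scoped ModuleCat.Algebra in
/-- The control object makes the submodule category controlled wild. -/
theorem isControlClass_controlObject {R : Type u} [CommRing R] [IsLocalRing R] {t : R}
    (ht : maximalIdeal R = Ideal.span {t}) (hR : TorsionDivisible t R) :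
    IsControlClass (ResidueField R) (ObjectProperty.singleton (controlObject t)) := by
  let k := ResidueField R
  have hfin : ∀ V : FreeAlgebraMod k, Module.Finite k V.obj := fun V => V.property
  choose lift hlift using fun (V : FreeAlgebraMod k) (i : Fin 2) =>
    exists_cover_lift (R := R) (Algebra.lsmul k k V.obj (FreeAlgebra.ι k i))
  let obj : FreeAlgebraMod k → SubmodulePair R := fun V => companionModel t (lift V 0) (lift V 1)
  have hex : ∀ (V W : FreeAlgebraMod k) (f : obj V ⟶ obj W),
      ∃ h : V ⟶ W, Induces f h.hom.hom := fun V W f => by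
    obtain ⟨h, h0, h1, hf⟩ := exists_induces ht hR (hlift V 0) (hlift V 1) (hlift W 0) (hlift W 1) f
    exact ⟨ObjectProperty.homMk (ModuleCat.ofHom (h.ofFreeAlgebra (Fin.forall_fin_two.2 ⟨h0, h1⟩))),
      hf⟩
  choose Φ hΦ using hex
  have hext : ∀ {V W : FreeAlgebraMod k} {h h' : V ⟶ W},
      h = h' ↔ (h.hom.hom : V.obj → W.obj) = h'.hom.hom := fun {V W h h'} =>
    ⟨fun e => by rw [e],
      fun e => ObjectProperty.hom_ext _ (ModuleCat.hom_ext (DFunLike.coe_injective e))⟩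
  have hker : ∀ {V W : FreeAlgebraMod k} {f g : obj V ⟶ obj W} {h h' : V ⟶ W},
      Induces f h.hom.hom → Induces g h'.hom.hom →
      (h = h' ↔ FactorsThroughSum (ObjectProperty.singleton (controlObject t)) (f - g)) :=
    fun hf hg => hext.trans (Induces.eq_iff ht hR hf hg)
  -- Uniqueness of the induced map makes the choice `Φ` functorial.
  have huniq : ∀ {V W : FreeAlgebraMod k} {f : obj V ⟶ obj W} {h h' : V ⟶ W},
      Induces f h.hom.hom → Induces f h'.hom.hom → h = h' := fun hf hf' =>
    (hker hf hf').2 (by rw [sub_self]; exact .zero)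
  refine exists_factorCategory_equivalence (controlObject t) obj (fun {V W} => Φ V W)
    (fun V => huniq (hΦ V V _) (Induces.id ht hR))
    (fun {U V W} f g => huniq (hΦ U W _) ((hΦ U V f).comp (hΦ V W g)))
    (fun {V W} h => ?_) (fun f g => hker (hΦ _ _ f) (hΦ _ _ g))
    ⟨ModuleCat.of _ PUnit, ?_⟩ (fun f g => hext.2 (funext fun x => Subsingleton.elim _ _))
  · obtain ⟨f, hf⟩ := exists_induces_of_linearMap ht hR (hlift V 0) (hlift V 1) (hlift W 0)
      (hlift W 1) (h.hom.hom.restrictScalars k) (fun x => map_smul h.hom.hom _ x)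
      (fun x => map_smul h.hom.hom _ x)
    exact ⟨f, huniq (hΦ V W f) hf⟩
  · have : Finite (ModuleCat.of (FreeAlgebra k (Fin 2)) PUnit.{u + 1}) :=
      inferInstanceAs (Finite PUnit)
    exact Module.Finite.of_finite

end SubmodulePair

theorem theorem2 (Λ : Type u) [CommRing Λ] [IsLocalRing Λ] (huniserial : IsUniserialRing Λ)
    (n : ℕ) (hn : 7 ≤ n) (hlength : Module.length Λ Λ = n) :
    IsControlledWild (IsLocalRing.ResidueField Λ) (SubmodulePair Λ) ∧
      ∃ I : SubmodulePair Λ,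
        IsControlClass (IsLocalRing.ResidueField Λ) (ObjectProperty.singleton I) := by
  -- Used with `N = 6`, so that `t ^ 6 ≠ 0`.
  obtain ⟨t, ht, hann⟩ := huniserial.exists_uniformizer hn hlength
  have h := SubmodulePair.isControlClass_controlObject ht fun i hi v hv => hann i hi v hv
  exact ⟨⟨_, h⟩, _, h⟩
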